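/- Let $M=(\mathbb{C}\cup\{\infty\})\setminus\{0,\infty,1\}$ and let $d\sigma^2$ be a smooth conformal metric of constant curvature $1$ on $M$. Suppose that $0$, $\infty$ and $1$ are conical singularities of $d\sigma^2$ of orders $\beta_1$, $\beta_2$ and $1$ respectively, where $\beta_1,\beta_2>-1$ are real numbers that are not integers. Here a point $p$ is a conical singularity of order $\beta>-1$ if, in a local holomorphic coordinate $\zeta$ centred at $p$, the metric is asymptotic to $C|\zeta|^{2\beta}\,|d\zeta|^2$ at $\zeta=0$ for some constant $C>0$; so $d\sigma^2$ has divisor $\beta_1\cdot 0+\beta_2\cdot\infty+1\cdot(1)$. Then there are $c\in\mathbb{C}\setminus\{0\}$ and $\mu\in\mathbb{R}\setminus\{0\}$ with $$\beta_1=|\mu|-1,\qquad \beta_2=|\mu+1|-1,$$ such that $$g=c\,z^{\mu}\Bigl(z-\frac{\mu+1}{\mu}\Bigr)$$ is a developing map of $d\sigma^2$. That is, on the universal cover $\widetilde M$ of $M$, with $z^\mu=\exp(\mu\log z)$ for some branch of $\log z$ on $\widetilde M$, the map $g\colon\widetilde M\to\mathbb{C}\cup\{\infty\}$ is holomorphic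 and the pull-back of the Fubini-Study metric by $g$ is the lift of $d\sigma^2$: $$d\sigma^2=\frac{4\,dg\,d\bar g}{(1+g\bar g)^2}.$$ -/

import Mathlib

open Filter Topology

noncomputable section

/-- The Riemann sphere `ℂ ∪ {∞}`. -/
abbrev RiemannSphere : Type := OnePoint ℂ

namespace RiemannSphere

/-- The inversion `z ↦ 1 / z` of the sphere; it exchanges `0` and `∞`. -/
def inv : RiemannSphere → RiemannSphere
  | none => ((0 : ℂ) : OnePoint ℂ)
  | some z => open Classical in if z = 0 then OnePoint.infty else ((z⁻¹ : ℂ) : OnePoint ℂ)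

/-- The standard holomorphic coordinate centred at a point `P`, evaluated at a point near `P`:
it is `z - p` at a finite point `p`, and `1 / z` (with value `0` at `∞`) at `P = ∞`.
Only its germ at `P` is meaningful. -/
def coord : RiemannSphere → RiemannSphere → ℂ
  | none, none => 0
  | none, some z => z⁻¹
  | some p, some z => z - p
  | some _, none => 0

end RiemannSphere

/-- The Gaussian curvature `- Δ (log ρ) / (2 ρ)` of the conformal metric `ρ |dζ|²`. -/
def gaussianCurvature (ρ : ℂ → ℝ) (ζ : ℂ) : ℝ :=
  -(Laplacian.laplacian (fun w : ℂ => Real.log (ρ w)) ζ) / (2 * ρ ζ)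

/-- The metric `ρ |dζ|²`, given near `ζ = 0`, has a conical singularity of order `β` at `ζ = 0`:
it is asymptotic to `c |ζ|^(2β) |dζ|²` for some `c > 0`. -/
def HasConicalOrder (ρ : ℂ → ℝ) (β : ℝ) : Prop :=
  ∃ c : ℝ, 0 < c ∧ Tendsto (fun ζ : ℂ => ρ ζ / ‖ζ‖ ^ (2 * β)) (𝓝[≠] 0) (𝓝 c)

/-- A conformal (pseudo)metric on the Riemann sphere, given by its densities in the two standard
charts: `fin z |dz|²` on `ℂ`, and `inf w |dw|²` in the coordinate `w = 1 / z`. No regularity is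
imposed here, and the values at singular points are irrelevant. -/
structure SphereMetric where
  fin : ℂ → ℝ
  inf : ℂ → ℝ
  compat : ∀ w : ℂ, w ≠ 0 → inf w = fin w⁻¹ / ‖w‖ ^ 4

namespace SphereMetric

/-- The density of the metric in the standard coordinate centred at `P`. -/
def density (m : SphereMetric) : RiemannSphere → ℂ → ℝ
  | none => m.inf
  | some p => fun ζ => m.fin (p + ζ)

/-- `m` belongs to `Met₁(ℂ ∪ {∞})` and has divisor `D`: away from the support of `D` it is a
smooth conformal metric of constant curvature `1`, and each point `P` of the support is a conical
singularity of order `D P > -1`. -/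
structure IsMetOne (m : SphereMetric) (D : RiemannSphere →₀ ℝ) : Prop where
  smooth : ∀ P, P ∉ D.support → ContDiffAt ℝ ((⊤ : ℕ∞) : WithTop ℕ∞) (m.density P) 0
  pos : ∀ P, P ∉ D.support → 0 < m.density P 0
  curvature : ∀ P, P ∉ D.support → gaussianCurvature (m.density P) 0 = 1
  order_gt : ∀ P, P ∈ D.support → -1 < D P
  conical : ∀ P, P ∈ D.support → HasConicalOrder (m.density P) (D P)

/-- Let `π : E → M` be the universal covering of `M`, the sphere minus the support of `D`.
A map `g : E → ℂ ∪ {∞}` is a developing map of `m` if it is holomorphic (for the complex structure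
lifted from `M`) and the pull-back of the Fubini-Study metric `4 |dx|² / (1 + |x|²)²` by `g`
is the lift of `m`. Near each `e : E` the map `g` is written as `f` or `1 / f`, where `f` is a
holomorphic function of the coordinate centred at `π e`; the Fubini-Study metric has the same
expression in the coordinates `x` and `1 / x`. -/
def IsDevelopingMap (m : SphereMetric) {D : RiemannSphere →₀ ℝ} {E : Type*} [TopologicalSpace E]
    (π : E → {P : RiemannSphere // P ∉ D.support}) (g : E → RiemannSphere) : Prop :=
  ∀ e : E, ∃ f : ℂ → ℂ, AnalyticAt ℂ f 0 ∧
    ((∀ᶠ e' in 𝓝 e, g e' = (f (RiemannSphere.coord (π e) (π e')) : OnePoint ℂ)) ∨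
      (∀ᶠ e' in 𝓝 e,
        g e' = RiemannSphere.inv (f (RiemannSphere.coord (π e) (π e')) : OnePoint ℂ))) ∧
    ∀ᶠ ζ in 𝓝 (0 : ℂ),
      m.density (π e) ζ = 4 * ‖deriv f ζ‖ ^ 2 / (1 + ‖f ζ‖ ^ 2) ^ 2

end SphereMetric

end

/-!
Write the metric as `ρ |dz|²` and put `φ = ρ^(-1/2)`. Constant curvature `1` is Liouville's
equation `φ ∂∂̄φ - |∂φ|² = 1/4`, and it makes the projective connection `q = -2 ∂²φ / φ`
holomorphic on `ℂ ∖ {0, 1}`; `q` is the Schwarzian derivative of a developing map.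

At a cone of order `β` the function `q` has a double pole with coefficient `(1 - (β + 1)²) / 2`.
Only the leading asymptotics of `ρ` are assumed, so the derivatives of `φ` have to be controlled:
in the coordinate `t` with `z = z₀ (1 + t)^κ`, `κ = 1 / (β + 1)` (at `∞` with the opposite sign),
the metric is nearly flat, and since `φ` and `∂∂̄φ` are subharmonic, interior estimates
(`SolvesLiouville.local_estimate`) bound `∂φ` and `q` by the oscillation of `φ`
(`SolvesLiouville.tendsto_of_conical`). A holomorphic `q` with such double poles at `0`, `1` and
`∞` is a rational function given by the three coefficients (`eq_of_double_poles`).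

At `1`, where the order is `1`, the exponents of the equation `u'' + (q / 2) u = 0` differ by an
integer, and single-valuedness of the metric excludes logarithmic solutions. This gives a
quadratic relation between the Laurent coefficients of `q` at `1` (`SolvesLiouville.no_log`). Its
solutions are parametrised by a real number `μ` with `μ² = (β₁ + 1)²` and `(μ + 1)² = (β₂ + 1)²`
(`SolvesLiouville.exists_exponent`).

For this `q` the function `z^μ (z - (μ + 1) / μ)` has Schwarzian derivative `q`, so the
developing map is a Möbius transform of it. As `μ` is not an integer, the monodromy around `0`
forbids all Möbius transformations compatible with a single-valued metric, up to isometries of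
the sphere, except multiplication by a constant. In terms of `φ`, the terms to be excluded are
single-valued multiples of `z^(μ-1) (z - 1)`, and those vanish (`eq_zero_of_monodromy`); this
leaves an explicit formula for `φ` (`SolvesLiouville.eq_explicit`). On the universal covering
`log z` exists (`exists_log_of_isCoveringMap`), and the formula says that the metric is the
pull-back of the Fubini-Study metric.
-/

noncomputable section

open ComplexConjugate

/-! ### Wirtinger calculus -/

/-- The real-linear map `v ↦ a v + b v̄` of `ℂ`, that is `a dz + b dz̄`. -/
def wirtingerCLM (a b : ℂ) : ℂ →L[ℝ] ℂ :=
  a • ContinuousLinearMap.id ℝ ℂ + b • (Complex.conjCLE : ℂ →L[ℝ] ℂ)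

@[simp] lemma wirtingerCLM_apply (a b v : ℂ) : wirtingerCLM a b v = a * v + b * conj v := by
  simp [wirtingerCLM]

lemma wirtingerCLM_ext {L : ℂ →L[ℝ] ℂ} {a b : ℂ} (h : ∀ v, L v = a * v + b * conj v) :
    L = wirtingerCLM a b := by
  ext v
  simp [h]

/-- `F` is real differentiable at `z` with Wirtinger derivatives `∂F = a` and `∂̄F = b`. -/
def HasWirtinger (F : ℂ → ℂ) (a b z : ℂ) : Prop := HasFDerivAt F (wirtingerCLM a b) z

namespace HasWirtinger

variable {F G : ℂ → ℂ} {a b a' b' z : ℂ}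

lemma congr_coeff (h : HasWirtinger F a b z) (ha : a = a') (hb : b = b') :
    HasWirtinger F a' b' z := ha ▸ hb ▸ h

lemma unique (h : HasWirtinger F a b z) (h' : HasWirtinger F a' b' z) : a = a' ∧ b = b' := by
  have e := HasFDerivAt.unique h h'
  have h1 := congrArg (fun L : ℂ →L[ℝ] ℂ => L 1) e
  have h2 := congrArg (fun L : ℂ →L[ℝ] ℂ => L Complex.I) e
  simp only [wirtingerCLM_apply, map_one, mul_one, Complex.conj_I] at h1 h2
  have h3 : (a - a') - (b - b') = 0 := by
    have : Complex.I * ((a - a') - (b - b')) = 0 := by linear_combination h2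
    simpa using this
  constructor
  · linear_combination (h1 + h3) / 2
  · linear_combination (h1 - h3) / 2

lemma continuousAt (h : HasWirtinger F a b z) : ContinuousAt F z :=
  HasFDerivAt.continuousAt h

lemma congr_of_eventuallyEq (h : HasWirtinger F a b z) (e : G =ᶠ[𝓝 z] F) :
    HasWirtinger G a b z := HasFDerivAt.congr_of_eventuallyEq h e

lemma of_hasDerivAt (h : HasDerivAt F a z) : HasWirtinger F a 0 z := by
  have := h.hasFDerivAt.restrictScalars ℝ
  refine this.congr_fderiv ?_
  ext v
  simp [mul_comm]

lemma hasDerivAt (h : HasWirtinger F a 0 z) : HasDerivAt F a z := by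
  rw [hasDerivAt_iff_hasFDerivAt]
  refine hasFDerivAt_of_restrictScalars ℝ h ?_
  ext v
  simp [mul_comm]

lemma const (c z : ℂ) : HasWirtinger (fun _ => c) 0 0 z := of_hasDerivAt (hasDerivAt_const z c)

lemma id (z : ℂ) : HasWirtinger (fun w => w) 1 0 z := of_hasDerivAt (hasDerivAt_id z)

lemma add (h : HasWirtinger F a b z) (h' : HasWirtinger G a' b' z) :
    HasWirtinger (fun w => F w + G w) (a + a') (b + b') z := by
  have := HasFDerivAt.add h h'
  refine this.congr_fderiv ?_
  ext v
  simp
  try ring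

lemma sub (h : HasWirtinger F a b z) (h' : HasWirtinger G a' b' z) :
    HasWirtinger (fun w => F w - G w) (a - a') (b - b') z := by
  have := HasFDerivAt.sub h h'
  refine this.congr_fderiv ?_
  ext v
  simp
  try ring

lemma mul (h : HasWirtinger F a b z) (h' : HasWirtinger G a' b' z) :
    HasWirtinger (fun w => F w * G w) (a * G z + F z * a') (b * G z + F z * b') z := by
  have := HasFDerivAt.mul h h'
  refine this.congr_fderiv ?_
  ext v
  simp
  try ring

lemma conjugate (h : HasWirtinger F a b z) :
    HasWirtinger (fun w => conj (F w)) (conj b) (conj a) z := by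
  have := (Complex.conjCLE : ℂ →L[ℝ] ℂ).hasFDerivAt.comp z h
  refine this.congr_fderiv ?_
  ext v
  simp
  try ring

/-- Chain rule with a holomorphic outer function. -/
lemma comp_left {g : ℂ → ℂ} {g' : ℂ} (hg : HasDerivAt g g' (F z)) (h : HasWirtinger F a b z) :
    HasWirtinger (fun w => g (F w)) (g' * a) (g' * b) z := by
  have := (hg.hasFDerivAt.restrictScalars ℝ).comp z h
  refine this.congr_fderiv ?_
  ext v
  simp
  try ring

/-- Chain rule with a holomorphic inner function. -/
lemma comp_right {h : ℂ → ℂ} {h' : ℂ} (H : HasWirtinger F a b (h z)) (hh : HasDerivAt h h' z) :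
    HasWirtinger (fun w => F (h w)) (a * h') (b * conj h') z := by
  have := HasFDerivAt.comp z H (hh.hasFDerivAt.restrictScalars ℝ)
  refine this.congr_fderiv ?_
  ext v
  simp
  try ring

/-- Chain rule along a real curve. -/
lemma comp_curve {γ : ℝ → ℂ} {γ' : ℂ} {t : ℝ} (H : HasWirtinger F a b (γ t))
    (hγ : HasDerivAt γ γ' t) :
    HasDerivAt (fun t => F (γ t)) (a * γ' + b * conj γ') t := by
  have := HasFDerivAt.comp_hasDerivAt t H hγ
  rw [wirtingerCLM_apply] at this
  exact this

lemma const_mul (c : ℂ) (h : HasWirtinger F a b z) :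
    HasWirtinger (fun w => c * F w) (c * a) (c * b) z :=
  ((const c z).mul h).congr_coeff (by simp) (by simp)

lemma inv (h : HasWirtinger F a b z) (h0 : F z ≠ 0) :
    HasWirtinger (fun w => (F w)⁻¹) (-a / F z ^ 2) (-b / F z ^ 2) z :=
  (comp_left (hasDerivAt_inv h0) h).congr_coeff (by ring) (by ring)

lemma div (h : HasWirtinger F a b z) (h' : HasWirtinger G a' b' z) (h0 : G z ≠ 0) :
    HasWirtinger (fun w => F w / G w) ((a * G z - F z * a') / G z ^ 2)
      ((b * G z - F z * b') / G z ^ 2) z := by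
  refine ((h.mul (h'.inv h0)).congr_coeff ?_ ?_).congr_of_eventuallyEq
    (Eventually.of_forall fun w => div_eq_mul_inv _ _) <;> field_simp <;> ring

end HasWirtinger

/-- The Wirtinger derivative `∂F / ∂z`. -/
def dz (F : ℂ → ℂ) (z : ℂ) : ℂ := (fderiv ℝ F z 1 - Complex.I * fderiv ℝ F z Complex.I) / 2

/-- The Wirtinger derivative `∂F / ∂z̄`. -/
def dzbar (F : ℂ → ℂ) (z : ℂ) : ℂ := (fderiv ℝ F z 1 + Complex.I * fderiv ℝ F z Complex.I) / 2

lemma DifferentiableAt.hasWirtinger {F : ℂ → ℂ} {z : ℂ} (h : DifferentiableAt ℝ F z) :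
    HasWirtinger F (dz F z) (dzbar F z) z := by
  unfold HasWirtinger
  convert h.hasFDerivAt using 1
  symm
  apply wirtingerCLM_ext
  intro v
  have hv : v = v.re • (1 : ℂ) + v.im • Complex.I := by
    apply Complex.ext <;> simp
  conv_lhs => rw [hv, map_add, map_smul, map_smul]
  have h2 : conj v = v.re - v.im * Complex.I := by apply Complex.ext <;> simp
  have h3 : v = v.re + v.im * Complex.I := by simp
  rw [h2]
  nth_rw 3 [h3]
  simp only [dz, dzbar, Complex.real_smul]
  linear_combination ((v.im : ℂ) * fderiv ℝ F z Complex.I) * Complex.I_sq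

section Smooth

variable {F : ℂ → ℂ} {U : Set ℂ}

lemma contDiffOn_dz (hU : IsOpen U) (h : ContDiffOn ℝ ((⊤ : ℕ∞) : WithTop ℕ∞) F U) :
    ContDiffOn ℝ ((⊤ : ℕ∞) : WithTop ℕ∞) (dz F) U := by
  have h1 : ContDiffOn ℝ ((⊤ : ℕ∞) : WithTop ℕ∞) (fderiv ℝ F) U :=
    h.fderiv_of_isOpen hU (by simp)
  unfold dz
  have h2 := h1.clm_apply (contDiffOn_const (c := (1 : ℂ)))
  have h3 := h1.clm_apply (contDiffOn_const (c := Complex.I))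
  exact (h2.sub (contDiffOn_const.mul h3)).div_const 2

lemma contDiffOn_dzbar (hU : IsOpen U) (h : ContDiffOn ℝ ((⊤ : ℕ∞) : WithTop ℕ∞) F U) :
    ContDiffOn ℝ ((⊤ : ℕ∞) : WithTop ℕ∞) (dzbar F) U := by
  have h1 : ContDiffOn ℝ ((⊤ : ℕ∞) : WithTop ℕ∞) (fderiv ℝ F) U :=
    h.fderiv_of_isOpen hU (by simp)
  unfold dzbar
  have h2 := h1.clm_apply (contDiffOn_const (c := (1 : ℂ)))
  have h3 := h1.clm_apply (contDiffOn_const (c := Complex.I))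
  exact (h2.add (contDiffOn_const.mul h3)).div_const 2

lemma ContDiffOn.hasWirtinger (hU : IsOpen U)
    (h : ContDiffOn ℝ ((⊤ : ℕ∞) : WithTop ℕ∞) F U) {z : ℂ} (hz : z ∈ U) :
    HasWirtinger F (dz F z) (dzbar F z) z :=
  ((h.contDiffAt (hU.mem_nhds hz)).differentiableAt (by simp)).hasWirtinger

lemma dz_apply_fderiv (hU : IsOpen U) (h : ContDiffOn ℝ ((⊤ : ℕ∞) : WithTop ℕ∞) F U) {z : ℂ}
    (hz : z ∈ U) (w : ℂ) :
    fderiv ℝ (dz F) z w = (fderiv ℝ (fderiv ℝ F) z w 1 -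
      Complex.I * fderiv ℝ (fderiv ℝ F) z w Complex.I) / 2 ∧
    fderiv ℝ (dzbar F) z w = (fderiv ℝ (fderiv ℝ F) z w 1 +
      Complex.I * fderiv ℝ (fderiv ℝ F) z w Complex.I) / 2 := by
  have h1 : ContDiffOn ℝ ((⊤ : ℕ∞) : WithTop ℕ∞) (fderiv ℝ F) U :=
    h.fderiv_of_isOpen hU (by simp)
  have h2 : DifferentiableAt ℝ (fderiv ℝ F) z :=
    (h1.contDiffAt (hU.mem_nhds hz)).differentiableAt (by simp)
  have h3 : ∀ v, HasFDerivAt (fun y => fderiv ℝ F y v)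
      ((fderiv ℝ (fderiv ℝ F) z).flip v) z := fun v => by
    have := h2.hasFDerivAt.clm_apply (hasFDerivAt_const v z)
    refine this.congr_fderiv ?_
    ext; simp
  have h4 := ((h3 1).sub ((h3 Complex.I).const_mul Complex.I)).mul_const (2⁻¹ : ℂ)
  have h5 := ((h3 1).add ((h3 Complex.I).const_mul Complex.I)).mul_const (2⁻¹ : ℂ)
  have h4' : HasFDerivAt (dz F) _ z := h4
  have h5' : HasFDerivAt (dzbar F) _ z := h5
  rw [h4'.fderiv, h5'.fderiv]
  constructor <;> simp <;> ring

/-- The two Wirtinger derivatives of a smooth function commute. -/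
lemma dzbar_dz_comm (hU : IsOpen U) (h : ContDiffOn ℝ ((⊤ : ℕ∞) : WithTop ℕ∞) F U) {z : ℂ}
    (hz : z ∈ U) : dzbar (dz F) z = dz (dzbar F) z := by
  have hs : IsSymmSndFDerivAt ℝ F z :=
    (h.contDiffAt (hU.mem_nhds hz)).isSymmSndFDerivAt (by
      rw [minSmoothness_of_isRCLikeNormedField]
      exact WithTop.coe_le_coe.2 (le_top (a := (2 : ℕ∞))))
  have := hs.eq 1 Complex.I
  rw [dzbar, dz, (dz_apply_fderiv hU h hz _).1, (dz_apply_fderiv hU h hz _).1,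
    (dz_apply_fderiv hU h hz _).2, (dz_apply_fderiv hU h hz _).2, this]
  ring

/-- `4 ∂∂̄` is the Laplacian. -/
lemma four_mul_dzbar_dz (hU : IsOpen U) (h : ContDiffOn ℝ ((⊤ : ℕ∞) : WithTop ℕ∞) F U) {z : ℂ}
    (hz : z ∈ U) : 4 * dzbar (dz F) z = Laplacian.laplacian F z := by
  have hs : IsSymmSndFDerivAt ℝ F z :=
    (h.contDiffAt (hU.mem_nhds hz)).isSymmSndFDerivAt (by
      rw [minSmoothness_of_isRCLikeNormedField]
      exact WithTop.coe_le_coe.2 (le_top (a := (2 : ℕ∞))))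
  have := hs.eq 1 Complex.I
  rw [InnerProductSpace.laplacian_eq_iteratedFDeriv_complexPlane]
  simp only [iteratedFDeriv_two_apply]
  rw [dzbar, (dz_apply_fderiv hU h hz _).1, (dz_apply_fderiv hU h hz _).1, this]
  simp
  linear_combination (-fderiv ℝ (fderiv ℝ F) z Complex.I Complex.I) * Complex.I_sq

end Smooth

open Metric Set

/-! ### Integrals over circles -/

lemma hasDerivAt_integral_param {P P' : ℝ → ℝ → ℂ} {R r : ℝ} (hr : r ∈ Ioo (-R) R)
    (hP : ∀ r ∈ Ioo (-R) R, Continuous (P r))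
    (hd : ∀ r ∈ Ioo (-R) R, ∀ θ, HasDerivAt (fun r => P r θ) (P' r θ) r)
    (hc : ContinuousOn (fun p : ℝ × ℝ => P' p.1 p.2) (Ioo (-R) R ×ˢ univ)) (T : ℝ) :
    HasDerivAt (fun r => ∫ θ in (0 : ℝ)..T, P r θ) (∫ θ in (0 : ℝ)..T, P' r θ) r := by
  obtain ⟨ε, hε, hε'⟩ := Metric.nhds_basis_closedBall.mem_iff.1 (isOpen_Ioo.mem_nhds hr)
  have hcomp : IsCompact (closedBall r ε ×ˢ uIcc 0 T) :=
    (isCompact_closedBall r ε).prod isCompact_uIcc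
  obtain ⟨C, hC⟩ := hcomp.exists_bound_of_continuousOn
    (hc.mono (prod_mono hε' (subset_univ _)))
  have hP'c : Continuous (P' r) := by
    have : ContinuousOn (fun θ => P' r θ) univ :=
      hc.comp (f := fun θ : ℝ => (r, θ)) (by fun_prop) (fun θ _ => ⟨hr, mem_univ _⟩)
    exact continuousOn_univ.1 this
  refine (intervalIntegral.hasDerivAt_integral_of_dominated_loc_of_deriv_le
    (F := P) (F' := P') (bound := fun _ => C) (closedBall_mem_nhds r hε) ?_
    ((hP r hr).intervalIntegrable _ _) hP'c.aestronglyMeasurable ?_ (by simp) ?_).2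
  · filter_upwards [isOpen_Ioo.mem_nhds hr] with x hx
    exact (hP x hx).aestronglyMeasurable
  · refine Eventually.of_forall fun θ hθ x hx => ?_
    exact hC (x, θ) ⟨hx, uIoc_subset_uIcc hθ⟩
  · exact Eventually.of_forall fun θ _ x hx => hd x (hε' hx) θ

lemma circleMap_mem_ball_of_mem_Ioo {c : ℂ} {R r : ℝ} (hr : r ∈ Ioo (-R) R) (θ : ℝ) :
    circleMap c r θ ∈ ball c R := by
  simpa [circleMap, abs_lt] using hr

lemma hasDerivAt_circleMap_radius (c : ℂ) (r θ : ℝ) :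
    HasDerivAt (fun r : ℝ => circleMap c r θ) (Complex.exp (θ * Complex.I)) r := by
  have := ((Complex.ofRealCLM.hasDerivAt (x := r)).mul_const
    (Complex.exp (θ * Complex.I))).const_add c
  simpa [circleMap] using this

lemma conj_exp_ofReal_mul_I (θ : ℝ) :
    conj (Complex.exp (θ * Complex.I)) = Complex.exp (-(θ * Complex.I)) := by
  rw [← Complex.exp_conj]
  simp

section

variable {G a b : ℂ → ℂ} {c : ℂ} {R : ℝ}

lemma continuous_comp_circleMap {F : ℂ → ℂ} {r : ℝ} (hF : ContinuousOn F (ball c R))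
    (hr : r ∈ Ioo (-R) R) : Continuous fun θ => F (circleMap c r θ) :=
  continuousOn_univ.1 (hF.comp (continuous_circleMap c r).continuousOn
    fun θ _ => circleMap_mem_ball_of_mem_Ioo hr θ)

/-- The angular derivative of a function integrates to zero over a circle. -/
lemma integral_angular_deriv_eq_zero {r : ℝ}
    (hG : ∀ θ, HasWirtinger G (a (circleMap c r θ)) (b (circleMap c r θ)) (circleMap c r θ))
    (ha : Continuous fun θ => a (circleMap c r θ)) (hb : Continuous fun θ => b (circleMap c r θ)) :
    ∫ θ in (0 : ℝ)..2 * Real.pi, (a (circleMap c r θ) * (r * Complex.exp (θ * Complex.I)) -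
      b (circleMap c r θ) * (r * Complex.exp (-(θ * Complex.I)))) = 0 := by
  have hd : ∀ θ : ℝ, HasDerivAt (fun θ => -Complex.I * G (circleMap c r θ))
      (a (circleMap c r θ) * (r * Complex.exp (θ * Complex.I)) -
      b (circleMap c r θ) * (r * Complex.exp (-(θ * Complex.I)))) θ := by
    intro θ
    have := ((hG θ).comp_curve (hasDerivAt_circleMap c r θ)).const_mul (-Complex.I)
    refine this.congr_deriv ?_
    rw [map_mul, circleMap_zero, map_mul, Complex.conj_ofReal, conj_exp_ofReal_mul_I,
      Complex.conj_I]
    linear_combination -(a (circleMap c r θ) * (r * Complex.exp (θ * Complex.I)) -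
      b (circleMap c r θ) * (r * Complex.exp (-(θ * Complex.I)))) * Complex.I_sq
  rw [intervalIntegral.integral_eq_sub_of_hasDerivAt (fun θ _ => hd θ)
    (((ha.mul (by fun_prop)).sub (hb.mul (by fun_prop))).intervalIntegrable _ _)]
  have := periodic_circleMap c r 0
  rw [zero_add] at this
  simp [this]

/-- The radial derivative of circle integrals is twice the contribution of either Wirtinger
derivative, since the angular derivative integrates to zero. -/
lemma hasDerivAt_circle_integral (hG : ∀ z ∈ ball c R, HasWirtinger G (a z) (b z) z)
    (ha : ContinuousOn a (ball c R)) (hb : ContinuousOn b (ball c R)) {r : ℝ}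
    (hr : r ∈ Ioo (-R) R) :
    HasDerivAt (fun r => ∫ θ in (0 : ℝ)..2 * Real.pi, G (circleMap c r θ))
      (2 * ∫ θ in (0 : ℝ)..2 * Real.pi, a (circleMap c r θ) * Complex.exp (θ * Complex.I)) r ∧
    HasDerivAt (fun r => ∫ θ in (0 : ℝ)..2 * Real.pi, G (circleMap c r θ))
      (2 * ∫ θ in (0 : ℝ)..2 * Real.pi,
        b (circleMap c r θ) * Complex.exp (-(θ * Complex.I))) r := by
  have hGc : ContinuousOn G (ball c R) := fun z hz => (hG z hz).continuousAt.continuousWithinAt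
  have hmaps : MapsTo (fun p : ℝ × ℝ => circleMap c p.1 p.2) (Ioo (-R) R ×ˢ univ) (ball c R) :=
    fun p hp => circleMap_mem_ball_of_mem_Ioo hp.1 p.2
  have hcm : Continuous fun p : ℝ × ℝ => circleMap c p.1 p.2 := by
    unfold circleMap
    fun_prop
  have hca := ha.comp hcm.continuousOn hmaps
  have hcb := hb.comp hcm.continuousOn hmaps
  simp only [Function.comp_def] at hca hcb
  have main := hasDerivAt_integral_param (P := fun r θ => G (circleMap c r θ))
    (P' := fun r θ => a (circleMap c r θ) * Complex.exp (θ * Complex.I) +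
      b (circleMap c r θ) * Complex.exp (-(θ * Complex.I))) hr
    (fun r hr => continuous_comp_circleMap hGc hr)
    (fun r hr θ => by
      have := HasWirtinger.comp_curve (γ := fun r : ℝ => circleMap c r θ) (t := r)
        (hG _ (circleMap_mem_ball_of_mem_Ioo hr θ)) (hasDerivAt_circleMap_radius c r θ)
      rwa [conj_exp_ofReal_mul_I] at this)
    (by fun_prop) (2 * Real.pi)
  have hcar := continuous_comp_circleMap ha hr
  have hcbr := continuous_comp_circleMap hb hr
  have iA : IntervalIntegrable (fun θ : ℝ => a (circleMap c r θ) * Complex.exp (θ * Complex.I))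
    MeasureTheory.volume 0 (2 * Real.pi) := (hcar.mul (by fun_prop)).intervalIntegrable _ _
  have iB : IntervalIntegrable (fun θ : ℝ => b (circleMap c r θ) * Complex.exp (-(θ * Complex.I)))
    MeasureTheory.volume 0 (2 * Real.pi) := (hcbr.mul (by fun_prop)).intervalIntegrable _ _
  rw [intervalIntegral.integral_add iA iB] at main
  have hAB : (∫ θ in (0 : ℝ)..2 * Real.pi, a (circleMap c r θ) * Complex.exp (θ * Complex.I)) =
      ∫ θ in (0 : ℝ)..2 * Real.pi, b (circleMap c r θ) * Complex.exp (-(θ * Complex.I)) := by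
    rcases eq_or_ne r 0 with rfl | h0
    · have e : ∀ (s : ℂ), s ≠ 0 → Complex.exp (s * (2 * Real.pi)) = 1 →
          ∫ θ in (0 : ℝ)..2 * Real.pi, Complex.exp (s * θ) = 0 := by
        intro s hs he
        rw [integral_exp_mul_complex hs]
        simp [he]
      have e1 := e Complex.I Complex.I_ne_zero (by rw [mul_comm]; exact Complex.exp_two_pi_mul_I)
      have e2 := e (-Complex.I) (by simp) (by
        rw [neg_mul, Complex.exp_neg, mul_comm, Complex.exp_two_pi_mul_I, inv_one])
      simp only [circleMap_zero_radius, Function.const_apply, intervalIntegral.integral_const_mul]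
      simp only [mul_comm Complex.I, neg_mul] at e1 e2
      simp [e1, e2]
    · have h := integral_angular_deriv_eq_zero (G := G) (a := a) (b := b) (c := c) (r := r)
        (fun θ => hG _ (circleMap_mem_ball_of_mem_Ioo hr θ)) hcar hcbr
      have h' : (r : ℂ) * ((∫ θ in (0 : ℝ)..2 * Real.pi,
          a (circleMap c r θ) * Complex.exp (θ * Complex.I)) -
          ∫ θ in (0 : ℝ)..2 * Real.pi,
            b (circleMap c r θ) * Complex.exp (-(θ * Complex.I))) = 0 := by
        rw [← intervalIntegral.integral_sub iA iB, ← intervalIntegral.integral_const_mul, ← h]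
        congr 1
        ext θ
        ring
      have := (mul_eq_zero.1 h').resolve_left (by exact_mod_cast h0)
      exact sub_eq_zero.1 this
  constructor
  · exact main.congr_deriv (by rw [← hAB]; ring)
  · exact main.congr_deriv (by rw [hAB]; ring)

/-- A quantitative sub-mean-value property: a lower bound `m` for the circle means of `∂∂̄G`
bounds the circle means of `G` from below by `G c + m r²`. -/
lemma circle_integral_lower_bound {a' k : ℂ → ℂ} {m : ℝ}
    (hG : ∀ z ∈ ball c R, HasWirtinger G (a z) (b z) z) (hb : ContinuousOn b (ball c R))
    (ha : ∀ z ∈ ball c R, HasWirtinger a (a' z) (k z) z)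
    (ha' : ContinuousOn a' (ball c R)) (hk : ContinuousOn k (ball c R))
    (hm : ∀ r ∈ Ioo 0 R, 2 * Real.pi * m ≤ (∫ θ in (0 : ℝ)..2 * Real.pi, k (circleMap c r θ)).re)
    {r : ℝ} (hr : r ∈ Ico 0 R) :
    2 * Real.pi * ((G c).re + m * r ^ 2) ≤
      (∫ θ in (0 : ℝ)..2 * Real.pi, G (circleMap c r θ)).re := by
  have hac : ContinuousOn a (ball c R) := fun z hz => (ha z hz).continuousAt.continuousWithinAt
  have reD : ∀ {f : ℝ → ℂ} {f' : ℂ} {x : ℝ}, HasDerivAt f f' x →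
      HasDerivAt (fun x => (f x).re) f'.re x := fun h => by
    have := Complex.reCLM.hasFDerivAt.comp_hasDerivAt _ h
    exact this
  have hI : ∀ x ∈ Ico 0 R, HasDerivAt
      (fun r : ℝ => (∫ θ in (0 : ℝ)..2 * Real.pi,
        a (circleMap c r θ) * (circleMap c r θ - c)).re)
      (2 * (x * (∫ θ in (0 : ℝ)..2 * Real.pi, k (circleMap c x θ)).re)) x := by
    intro x hx
    have := (hasDerivAt_circle_integral (G := fun z => a z * (z - c))
      (a := fun z => a' z * (z - c) + a z * (1 - 0)) (b := fun z => k z * (z - c) + a z * (0 - 0))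
      (fun z hz => (ha z hz).mul ((HasWirtinger.id z).sub (HasWirtinger.const c z)))
      (by fun_prop) (by fun_prop) (r := x) ⟨by linarith [hx.1, hx.2], hx.2⟩).2
    have h2 := reD this
    convert h2 using 1
    have : ∀ θ : ℝ, (k (circleMap c x θ) * (circleMap c x θ - c) + a (circleMap c x θ) * (0 - 0)) *
        Complex.exp (-(θ * Complex.I)) = x * k (circleMap c x θ) := by
      intro θ
      have e : Complex.exp (θ * Complex.I) * Complex.exp (-(θ * Complex.I)) = 1 := by
        rw [← Complex.exp_add]; simp
      simp only [circleMap]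
      linear_combination k (c + x * Complex.exp (θ * Complex.I)) * x * e
    simp only [this, intervalIntegral.integral_const_mul]
    simp
  have mono : ∀ {f f' : ℝ → ℝ}, (∀ x ∈ Ico 0 R, HasDerivAt f (f' x) x) →
      (∀ x ∈ Ioo 0 R, 0 ≤ f' x) → ∀ x ∈ Ico 0 R, f 0 ≤ f x := by
    intro f f' h1 h2 x hx
    have : MonotoneOn f (Icc 0 x) := by
      refine monotoneOn_of_deriv_nonneg (convex_Icc 0 x)
        (fun y hy => (h1 y ⟨hy.1, hy.2.trans_lt hx.2⟩).continuousAt.continuousWithinAt)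
        (fun y hy => ?_) (fun y hy => ?_) <;> rw [interior_Icc] at hy
      · exact (h1 y ⟨hy.1.le, hy.2.trans hx.2⟩).differentiableAt.differentiableWithinAt
      · rw [(h1 y ⟨hy.1.le, hy.2.trans hx.2⟩).deriv]
        exact h2 y ⟨hy.1, hy.2.trans hx.2⟩
    exact this ⟨le_rfl, hx.1⟩ ⟨hx.1, le_rfl⟩ hx.1
  have sq : ∀ (m : ℝ) (x : ℝ), HasDerivAt (fun r : ℝ => m * r ^ 2) (m * (2 * x)) x := by
    intro m x
    simpa using (hasDerivAt_pow 2 x).const_mul m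
  have hI2 : ∀ x ∈ Ico 0 R, 2 * Real.pi * m * x ^ 2 ≤ (∫ θ in (0 : ℝ)..2 * Real.pi,
      a (circleMap c x θ) * (circleMap c x θ - c)).re := by
    intro x hx
    have := mono (fun x hx => (hI x hx).sub (sq (2 * Real.pi * m) x))
      (fun x hx => by nlinarith [hm x hx, hx.1]) x hx
    simpa using this
  have := mono (fun x hx => (reD (hasDerivAt_circle_integral hG hac hb
      (r := x) ⟨by linarith [hx.1, hx.2], hx.2⟩).1).sub (sq (2 * Real.pi * m) x))
      (fun x hx => by
        have h := hI2 x ⟨hx.1.le, hx.2⟩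
        have e : (∫ θ in (0 : ℝ)..2 * Real.pi, a (circleMap c x θ) * (circleMap c x θ - c)) =
            x * ∫ θ in (0 : ℝ)..2 * Real.pi,
              a (circleMap c x θ) * Complex.exp (θ * Complex.I) := by
          rw [← intervalIntegral.integral_const_mul]
          congr 1
          ext θ
          simp [circleMap]
          ring
        rw [e, Complex.re_ofReal_mul] at h
        have h3 : 2 * Real.pi * m * x ≤ (∫ θ in (0 : ℝ)..2 * Real.pi,
              a (circleMap c x θ) * Complex.exp (θ * Complex.I)).re := by
          have := hx.1
          refine le_of_mul_le_mul_left ?_ hx.1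
          nlinarith
        simp only [Complex.mul_re, Complex.re_ofNat, Complex.im_ofNat]
        nlinarith) r hr
  simp at this
  nlinarith

end

/-! ### Liouville's equation and interior estimates -/

/-- `φ = ρ^(-1/2)` for a conformal metric `ρ |dz|²` of curvature `1` on the open set `U`, together
with its derivative `s = ∂φ` and its projective connection `q`. Liouville's equation takes the
form `φ ∂∂̄φ - |∂φ|² = 1/4`, and `q = -2 ∂²φ / φ` is then holomorphic. -/
structure SolvesLiouville (φ : ℂ → ℝ) (s q : ℂ → ℂ) (U : Set ℂ) : Prop where
  isOpen : IsOpen U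
  pos : ∀ z ∈ U, 0 < φ z
  hasWirtinger : ∀ z ∈ U, HasWirtinger (fun w => (φ w : ℂ)) (s z) (conj (s z)) z
  hasWirtinger_deriv : ∀ z ∈ U,
    HasWirtinger s (-(q z * φ z) / 2) ((1 / 4 + s z * conj (s z)) / φ z) z
  differentiableOn : DifferentiableOn ℂ q U

namespace SolvesLiouville

variable {φ : ℂ → ℝ} {s q : ℂ → ℂ} {U V : Set ℂ}

lemma ofReal_ne_zero (h : SolvesLiouville φ s q U) {z : ℂ} (hz : z ∈ U) : (φ z : ℂ) ≠ 0 :=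
  Complex.ofReal_ne_zero.2 (h.pos z hz).ne'

lemma continuousOn_ofReal (h : SolvesLiouville φ s q U) : ContinuousOn (fun w => (φ w : ℂ)) U :=
  fun z hz => (h.hasWirtinger z hz).continuousAt.continuousWithinAt

lemma continuousOn_deriv (h : SolvesLiouville φ s q U) : ContinuousOn s U :=
  fun z hz => (h.hasWirtinger_deriv z hz).continuousAt.continuousWithinAt

lemma q_hasWirtinger (h : SolvesLiouville φ s q U) {z : ℂ} (hz : z ∈ U) :
    HasWirtinger q (deriv q z) 0 z :=
  .of_hasDerivAt (h.differentiableOn.differentiableAt (h.isOpen.mem_nhds hz)).hasDerivAt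

lemma hasWirtinger_mixed (h : SolvesLiouville φ s q U) {z : ℂ} (hz : z ∈ U) :
    HasWirtinger (fun w => (1 / 4 + s w * conj (s w)) / φ w) (-(q z * conj (s z)) / 2)
      (-(conj (q z) * s z) / 2) z := by
  have h1 := h.hasWirtinger z hz
  have h2 := h.hasWirtinger_deriv z hz
  have h0 := h.ofReal_ne_zero hz
  refine (((HasWirtinger.const (1 / 4) z).add (h2.mul h2.conjugate)).div h1 h0).congr_coeff ?_ ?_
  · simp only [map_div₀, map_add, map_mul, Complex.conj_conj, Complex.conj_ofReal, map_one,
      map_ofNat]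
    field_simp
    ring
  · simp only [map_div₀, map_mul, map_neg, Complex.conj_ofReal, map_ofNat]
    field_simp
    ring

lemma hasWirtinger_mixed_deriv (h : SolvesLiouville φ s q U) {z : ℂ} (hz : z ∈ U) :
    HasWirtinger (fun w => -(q w * conj (s w)) / 2)
      (-(deriv q z * conj (s z) + q z * ((1 / 4 + s z * conj (s z)) / φ z)) / 2)
      (q z * conj (q z) * φ z / 4) z := by
  have h2 := h.hasWirtinger_deriv z hz
  have h0 := h.ofReal_ne_zero hz
  refine ((((h.q_hasWirtinger hz).mul h2.conjugate).const_mul (-1 / 2)).congr_coeff ?_ ?_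
    ).congr_of_eventuallyEq (Eventually.of_forall fun w => ?_)
  · simp only [map_div₀, map_add, map_mul, Complex.conj_conj, Complex.conj_ofReal, map_one,
      map_ofNat]
    ring
  · simp only [map_div₀, map_mul, map_neg, Complex.conj_ofReal, map_ofNat]
    ring
  · ring

lemma norm_sq_eq (z : ℂ) : z * conj z = ((‖z‖ ^ 2 : ℝ) : ℂ) := by
  rw [Complex.mul_conj, Complex.normSq_eq_norm_sq]

lemma mixed_re (z : ℂ) :
    ((1 / 4 + s z * conj (s z)) / φ z).re = (1 / 4 + ‖s z‖ ^ 2) / φ z := by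
  rw [norm_sq_eq]
  have : ((1 / 4 + ((‖s z‖ ^ 2 : ℝ) : ℂ)) / φ z) = (((1 / 4 + ‖s z‖ ^ 2) / φ z : ℝ) : ℂ) := by
    push_cast; ring
  rw [this, Complex.ofReal_re]

lemma circle_integral_le_of_le {f : ℂ → ℂ} {c : ℂ} {R r M : ℝ} (hf : ContinuousOn f (ball c R))
    (hr : r ∈ Ico 0 R) (hM : ∀ z ∈ ball c R, (f z).re ≤ M) :
    (∫ θ in (0 : ℝ)..2 * Real.pi, f (circleMap c r θ)).re ≤ 2 * Real.pi * M := by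
  have hr' : r ∈ Ioo (-R) R := ⟨by linarith [hr.1, hr.2], hr.2⟩
  have hc := continuous_comp_circleMap hf hr'
  have e : (∫ θ in (0 : ℝ)..2 * Real.pi, f (circleMap c r θ)).re =
      ∫ θ in (0 : ℝ)..2 * Real.pi, (f (circleMap c r θ)).re :=
    (Complex.reCLM.intervalIntegral_comp_comm (hc.intervalIntegrable _ _)).symm
  rw [e]
  calc _ ≤ ∫ θ in (0 : ℝ)..2 * Real.pi, M :=
        intervalIntegral.integral_mono_on (by positivity)
          ((Complex.continuous_re.comp hc).intervalIntegrable _ _) (by simp)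
          (fun θ _ => hM _ (circleMap_mem_ball_of_mem_Ioo hr' θ))
    _ = _ := by simp

lemma le_circle_integral_of_le {f : ℂ → ℂ} {c : ℂ} {R r M : ℝ} (hf : ContinuousOn f (ball c R))
    (hr : r ∈ Ico 0 R) (hM : ∀ z ∈ ball c R, M ≤ (f z).re) :
    2 * Real.pi * M ≤ (∫ θ in (0 : ℝ)..2 * Real.pi, f (circleMap c r θ)).re := by
  have := circle_integral_le_of_le (f := fun z => -f z) (M := -M) hf.neg hr
    (fun z hz => by simpa using hM z hz)
  rw [intervalIntegral.integral_neg] at this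
  simp only [Complex.neg_re] at this
  linarith

/-- `∂∂̄φ` at the centre of a disc is controlled by the oscillation of `φ`: `φ` and `∂∂̄φ` are
subharmonic. -/
lemma mixed_le (h : SolvesLiouville φ s q U) {c : ℂ} {R r M : ℝ} (hR : ball c R ⊆ U)
    (hr : r ∈ Ico 0 R) (hM : ∀ z ∈ ball c R, φ z ≤ M) :
    (1 / 4 + ‖s c‖ ^ 2) / φ c * r ^ 2 ≤ M - φ c := by
  have hR0 : 0 < R := hr.1.trans_lt hr.2
  have hc : c ∈ U := hR (mem_ball_self hR0)
  have hk : ContinuousOn (fun w => (1 / 4 + s w * conj (s w)) / φ w) (ball c R) := fun z hz =>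
    (h.hasWirtinger_mixed (hR hz)).continuousAt.continuousWithinAt
  have hqc : ContinuousOn q (ball c R) := h.differentiableOn.continuousOn.mono hR
  have hφc := h.continuousOn_ofReal.mono hR
  have hsc := h.continuousOn_deriv.mono hR
  have hcs : ContinuousOn (fun z => conj (s z)) (ball c R) :=
    Complex.continuous_conj.comp_continuousOn hsc
  have hcq : ContinuousOn (fun z => conj (q z)) (ball c R) :=
    Complex.continuous_conj.comp_continuousOn hqc
  have hq' : ContinuousOn (deriv q) (ball c R) :=
    ((h.differentiableOn.mono hR).deriv isOpen_ball).continuousOn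
  have hqq : ContinuousOn (fun z => q z * conj (q z) * φ z / 4) (ball c R) :=
    ((hqc.mul hcq).mul hφc).div_const 4
  have step1 : ∀ x ∈ Ico 0 R, 2 * Real.pi * ((1 / 4 + ‖s c‖ ^ 2) / φ c) ≤
      (∫ θ in (0 : ℝ)..2 * Real.pi,
        (fun w => (1 / 4 + s w * conj (s w)) / φ w) (circleMap c x θ)).re := by
    intro x hx
    have := circle_integral_lower_bound (m := 0)
      (fun z hz => h.hasWirtinger_mixed (hR hz)) ((hcq.mul hsc).neg.div_const 2)
      (fun z hz => h.hasWirtinger_mixed_deriv (hR hz))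
      (((hq'.mul hcs).add (hqc.mul hk)).neg.div_const 2)
      hqq (fun y hy => ?_) hx
    · rw [mixed_re] at this
      simpa using this
    · refine le_circle_integral_of_le hqq ⟨hy.1.le, hy.2⟩ ?_
      intro z hz
      have := (h.pos z (hR hz)).le
      rw [norm_sq_eq]
      have e : ((‖q z‖ ^ 2 : ℝ) : ℂ) * φ z / 4 = ((‖q z‖ ^ 2 * φ z / 4 : ℝ) : ℂ) := by
        push_cast; ring
      rw [e, Complex.ofReal_re]
      positivity
  have := circle_integral_lower_bound (m := (1 / 4 + ‖s c‖ ^ 2) / φ c)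
    (fun z hz => h.hasWirtinger z (hR hz)) hcs
    (fun z hz => h.hasWirtinger_deriv z (hR hz)) ((hqc.mul hφc).neg.div_const 2) hk
    (fun y hy => step1 y ⟨hy.1.le, hy.2⟩) hr
  have h2 := this.trans (circle_integral_le_of_le hφc hr (fun z hz => by simpa using hM z hz))
  have h3 := le_of_mul_le_mul_left h2 (by positivity)
  rw [Complex.ofReal_re] at h3
  linarith

/-- The projective connection at the centre of a disc is controlled by `∂∂̄φ`, by the mean value
property of `∂∂̄φ` and `∂²∂̄²φ = |q|² φ / 4`. -/
lemma norm_q_sq_le (h : SolvesLiouville φ s q U) {c : ℂ} {R r M m : ℝ} (hR : ball c R ⊆ U)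
    (hr : r ∈ Ico 0 R) (hm : 0 ≤ m) (hφm : ∀ z ∈ ball c R, m ≤ φ z)
    (hM : ∀ z ∈ ball c R, (1 / 4 + ‖s z‖ ^ 2) / φ z ≤ M) :
    ‖q c‖ ^ 2 * m / 4 * r ^ 2 ≤ M := by
  have hR0 : 0 < R := hr.1.trans_lt hr.2
  have hc : c ∈ U := hR (mem_ball_self hR0)
  have hk : ContinuousOn (fun w => (1 / 4 + s w * conj (s w)) / φ w) (ball c R) := fun z hz =>
    (h.hasWirtinger_mixed (hR hz)).continuousAt.continuousWithinAt
  have hqc : ContinuousOn q (ball c R) := h.differentiableOn.continuousOn.mono hR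
  have hφc := h.continuousOn_ofReal.mono hR
  have hsc := h.continuousOn_deriv.mono hR
  have hcs : ContinuousOn (fun z => conj (s z)) (ball c R) :=
    Complex.continuous_conj.comp_continuousOn hsc
  have hcq : ContinuousOn (fun z => conj (q z)) (ball c R) :=
    Complex.continuous_conj.comp_continuousOn hqc
  have hq' : ContinuousOn (deriv q) (ball c R) :=
    ((h.differentiableOn.mono hR).deriv isOpen_ball).continuousOn
  have hqq : ContinuousOn (fun z => q z * conj (q z) * φ z / 4) (ball c R) :=
    ((hqc.mul hcq).mul hφc).div_const 4
  have := circle_integral_lower_bound (m := ‖q c‖ ^ 2 * m / 4)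
      (fun z hz => h.hasWirtinger_mixed (hR hz)) ((hcq.mul hsc).neg.div_const 2)
      (fun z hz => h.hasWirtinger_mixed_deriv (hR hz))
      (((hq'.mul hcs).add (hqc.mul hk)).neg.div_const 2)
      hqq (fun y hy => ?_) hr
  · have h2 := this.trans (circle_integral_le_of_le hk hr
      (fun z hz => by rw [mixed_re]; exact hM z hz))
    have h3 := le_of_mul_le_mul_left h2 (by positivity)
    rw [mixed_re] at h3
    have : 0 ≤ (1 / 4 + ‖s c‖ ^ 2) / φ c := by
      have := h.pos c hc
      positivity
    linarith
  · have hy' : y ∈ Ioo (-R) R := ⟨by linarith [hy.1, hy.2], hy.2⟩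
    -- `2 Re (q̄(c) q) - |q(c)|²` is a harmonic minorant of `|q|²` with the same value at `c`
    have low : ∀ z ∈ ball c R, ((2 * conj (q c) * q z - q c * conj (q c)) * (m / 4 : ℝ)).re ≤
        (q z * conj (q z) * φ z / 4).re := by
      intro z hz
      rw [norm_sq_eq, norm_sq_eq]
      have e : ((‖q z‖ ^ 2 : ℝ) : ℂ) * φ z / 4 = ((‖q z‖ ^ 2 * φ z / 4 : ℝ) : ℂ) := by
        push_cast; ring
      rw [e, Complex.ofReal_re, Complex.re_mul_ofReal, Complex.sub_re, Complex.ofReal_re]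
      have e1 : (2 * conj (q c) * q z).re ≤ 2 * (‖q c‖ * ‖q z‖) := by
        refine (Complex.re_le_norm _).trans (le_of_eq ?_)
        simp [mul_assoc]
      have e2 := hφm z hz
      nlinarith [sq_nonneg (‖q c‖ - ‖q z‖), sq_nonneg (‖q z‖),
        mul_le_mul_of_nonneg_left e2 (sq_nonneg ‖q z‖),
        mul_nonneg hm (sq_nonneg (‖q c‖ - ‖q z‖)), mul_le_mul_of_nonneg_left e1 hm]
    have hF : DifferentiableOn ℂ (fun z => (2 * conj (q c) * q z - q c * conj (q c)) *
        ((m / 4 : ℝ) : ℂ)) (ball c R) :=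
      (((h.differentiableOn.mono hR).const_mul _).sub_const _).mul_const _
    have mv := circle_integral_lower_bound (m := 0) (c := c) (R := R)
      (G := fun z => (2 * conj (q c) * q z - q c * conj (q c)) * ((m / 4 : ℝ) : ℂ))
      (b := fun _ => 0)
      (fun z hz => .of_hasDerivAt (hF.differentiableAt (isOpen_ball.mem_nhds hz)).hasDerivAt)
      continuousOn_const (k := fun _ => 0)
      (fun z hz => .of_hasDerivAt
        ((hF.deriv isOpen_ball).differentiableAt (isOpen_ball.mem_nhds hz)).hasDerivAt)
      ((hF.deriv isOpen_ball).deriv isOpen_ball).continuousOn continuousOn_const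
      (fun _ _ => by simp) (r := y) ⟨hy.1.le, hy.2⟩
    have e0 : ((2 * conj (q c) * q c - q c * conj (q c)) * ((m / 4 : ℝ) : ℂ)).re =
        ‖q c‖ ^ 2 * m / 4 := by
      have : (2 * conj (q c) * q c - q c * conj (q c)) = ((‖q c‖ ^ 2 : ℝ) : ℂ) := by
        rw [← norm_sq_eq]; ring
      rw [this, ← Complex.ofReal_mul, Complex.ofReal_re]
      ring
    rw [e0] at mv
    simp only [zero_mul, add_zero] at mv
    refine mv.trans ?_
    have hFc := continuous_comp_circleMap hF.continuousOn hy'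
    have hKc := continuous_comp_circleMap hqq hy'
    have := le_circle_integral_of_le (M := 0) (f := fun z => q z * conj (q z) * φ z / 4 -
      (2 * conj (q c) * q z - q c * conj (q c)) * ((m / 4 : ℝ) : ℂ))
      (hqq.sub hF.continuousOn) ⟨hy.1.le, hy.2⟩ (fun z hz => by
        rw [Complex.sub_re, sub_nonneg]; exact low z hz)
    rw [intervalIntegral.integral_sub (hKc.intervalIntegrable _ _) (hFc.intervalIntegrable _ _),
      Complex.sub_re, mul_zero, sub_nonneg] at this
    exact this

/-- On the disc of radius `1/2`, the logarithmic derivative of `φ` and the projective connection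
at the centre are small if `φ` has small oscillation. -/
lemma local_estimate (h : SolvesLiouville φ s q (ball 0 (1 / 2))) {ε : ℝ} (hε : ε ≤ 1 / 2)
    (hφ : ∀ z ∈ ball (0 : ℂ) (1 / 2), |φ z - φ 0| ≤ ε * φ 0) :
    ‖s 0 / φ 0‖ ^ 2 ≤ 2 ^ 18 * ε ∧ ‖q 0‖ ^ 2 ≤ 2 ^ 18 * ε := by
  have h00 : (0 : ℂ) ∈ ball (0 : ℂ) (1 / 2) := mem_ball_self (by norm_num)
  have hφ0 := h.pos 0 h00
  have hε0 : 0 ≤ ε := by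
    have := hφ 0 h00
    simp only [sub_self, abs_zero] at this
    exact nonneg_of_mul_nonneg_left this hφ0
  have key : ∀ z ∈ ball (0 : ℂ) (1 / 4), (1 / 4 + ‖s z‖ ^ 2) / φ z ≤ 128 * ε * φ 0 := by
    intro z hz
    have hsub : ball z (1 / 4) ⊆ ball (0 : ℂ) (1 / 2) := by
      apply ball_subset_ball'
      rw [mem_ball] at hz
      linarith
    have h1 := h.mixed_le hsub (r := 1 / 8) (by norm_num) (M := (1 + ε) * φ 0) (fun w hw => by
      have := (abs_le.1 (hφ w (hsub hw))).2
      linarith)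
    have h2 := (abs_le.1 (hφ z (hsub (mem_ball_self (by norm_num))))).1
    nlinarith
  have hk := key 0 (mem_ball_self (by norm_num))
  constructor
  · rw [norm_div, Complex.norm_real, Real.norm_of_nonneg hφ0.le, div_pow,
      div_le_iff₀ (by positivity)]
    rw [div_le_iff₀ hφ0] at hk
    nlinarith [mul_nonneg hε0 (sq_nonneg (φ 0))]
  · have hsub : ball (0 : ℂ) (1 / 4) ⊆ ball (0 : ℂ) (1 / 2) := ball_subset_ball (by norm_num)
    have := h.norm_q_sq_le hsub (r := 1 / 8) (by norm_num) (m := φ 0 / 2) (by positivity)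
      (fun z hz => by
        have := (abs_le.1 (hφ z (hsub hz))).1
        nlinarith) key
    have h4 : ‖q 0‖ ^ 2 * φ 0 ≤ (2 ^ 18 * ε) * φ 0 := by nlinarith [mul_nonneg hε0 hφ0.le]
    exact le_of_mul_le_mul_right h4 hφ0

end SolvesLiouville

/-! ### Change of coordinate and asymptotics at a cone -/

namespace SolvesLiouville

variable {φ : ℂ → ℝ} {s q : ℂ → ℂ} {U V : Set ℂ}

lemma congr {ψ : ℂ → ℝ} (h : SolvesLiouville φ s q U) (e : ∀ z ∈ U, ψ z = φ z) :
    SolvesLiouville ψ s q U where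
  isOpen := h.isOpen
  pos z hz := by rw [e z hz]; exact h.pos z hz
  hasWirtinger z hz := (h.hasWirtinger z hz).congr_of_eventuallyEq <| by
    filter_upwards [h.isOpen.mem_nhds hz] with w hw
    rw [e w hw]
  hasWirtinger_deriv z hz := by rw [e z hz]; exact h.hasWirtinger_deriv z hz
  differentiableOn := h.differentiableOn

/-- Conformal change of coordinate `z = η t`: here `ℓ` is `(η')^(-1/2)` up to a constant of
modulus one, which is what `hE₁` and `hE₂` express. -/
lemma pullback (h : SolvesLiouville φ s q U) (hV : IsOpen V) {η η' η'' ℓ ℓ' ℓ'' : ℂ → ℂ}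
    (hη : ∀ t ∈ V, HasDerivAt η (η' t) t) (hη' : ∀ t ∈ V, HasDerivAt η' (η'' t) t)
    (hℓ : ∀ t ∈ V, HasDerivAt ℓ (ℓ' t) t) (hℓ' : ∀ t ∈ V, HasDerivAt ℓ' (ℓ'' t) t)
    (hℓ'' : DifferentiableOn ℂ ℓ'' V) (hmaps : MapsTo η V U)
    (hE₁ : ∀ t ∈ V, 2 * ℓ' t * η' t + ℓ t * η'' t = 0)
    (hE₂ : ∀ t ∈ V, (ℓ t * conj (ℓ t)) ^ 2 * (η' t * conj (η' t)) = 1) :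
    SolvesLiouville (fun t => φ (η t) * ‖ℓ t‖ ^ 2)
      (fun t => (s (η t) * η' t * ℓ t + φ (η t) * ℓ' t) * conj (ℓ t))
      (fun t => q (η t) * η' t ^ 2 - 2 * ℓ'' t / ℓ t) V := by
  have hℓ0 : ∀ t ∈ V, ℓ t ≠ 0 := fun t ht h0 => by
    have := hE₂ t ht
    simp [h0] at this
  have hcast : ∀ t, ((φ (η t) * ‖ℓ t‖ ^ 2 : ℝ) : ℂ) = φ (η t) * (ℓ t * conj (ℓ t)) := fun t => by
    rw [norm_sq_eq]; push_cast; ring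
  refine ⟨hV, fun t ht => ?_, fun t ht => ?_, fun t ht => ?_, fun t ht => ?_⟩
  · have := h.pos _ (hmaps ht)
    have := norm_pos_iff.2 (hℓ0 t ht)
    positivity
  · have h1 := (h.hasWirtinger _ (hmaps ht)).comp_right (hη t ht)
    have h2 := HasWirtinger.of_hasDerivAt (hℓ t ht)
    simp only [hcast]
    refine (h1.mul (h2.mul h2.conjugate)).congr_coeff ?_ ?_
    · simp only [map_zero]
      ring
    · simp only [map_add, map_mul, Complex.conj_conj, Complex.conj_ofReal]
      ring
  · have h1 := (h.hasWirtinger _ (hmaps ht)).comp_right (hη t ht)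
    have h2 := HasWirtinger.of_hasDerivAt (hℓ t ht)
    have h3 := HasWirtinger.of_hasDerivAt (hℓ' t ht)
    have h4 := HasWirtinger.of_hasDerivAt (hη' t ht)
    have h5 := (h.hasWirtinger_deriv _ (hmaps ht)).comp_right (hη t ht)
    have hφ0 := h.ofReal_ne_zero (hmaps ht)
    have hl0 := hℓ0 t ht
    have hl0' : conj (ℓ t) ≠ 0 := (map_ne_zero _).2 hl0
    refine ((((h5.mul h4).mul h2).add (h1.mul h3)).mul h2.conjugate).congr_coeff ?_ ?_
    · rw [hcast, map_zero]
      field_simp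
      linear_combination 2 * s (η t) * conj (ℓ t) * hE₁ t ht
    · have e2 := hE₂ t ht
      rw [hcast]
      simp only [map_add, map_mul, Complex.conj_conj, Complex.conj_ofReal]
      field_simp
      linear_combination e2
  · have h1 := ((h.differentiableOn.differentiableAt (h.isOpen.mem_nhds (hmaps ht))).comp t
      (hη t ht).differentiableAt)
    have h2 := (hη' t ht).differentiableAt
    have h3 := hℓ''.differentiableAt (hV.mem_nhds ht)
    have h4 := (hℓ t ht).differentiableAt
    have h5 : DifferentiableAt ℂ (fun t => q (η t)) t := h1
    exact ((h5.mul (h2.pow 2)).sub ((h3.const_mul 2).div h4 (hℓ0 t ht))).differentiableWithinAt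

lemma hasDerivAt_one_add_cpow (κ : ℂ) {t : ℂ} (ht : ‖t‖ < 1) :
    HasDerivAt (fun t : ℂ => (1 + t) ^ κ) (κ * (1 + t) ^ κ / (1 + t)) t := by
  have hs : 1 + t ∈ Complex.slitPlane := Complex.mem_slitPlane_of_norm_lt_one ht
  have h1 : HasDerivAt (fun t : ℂ => 1 + t) 1 t := (hasDerivAt_id t).const_add 1
  have := h1.cpow_const (c := κ) hs
  refine this.congr_deriv ?_
  rw [Complex.cpow_sub _ _ (Complex.slitPlane_ne_zero hs), Complex.cpow_one]
  ring

/-- The metric in the coordinate `t` with `z = z₀ (1 + t)^κ`, in which a cone of angle `2π / |κ|`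
becomes approximately flat. -/
lemma pullback_cpow (h : SolvesLiouville φ s q U) {z₀ : ℂ} (hz₀ : z₀ ≠ 0) {κ : ℝ} (hκ : κ ≠ 0)
    (hmaps : ∀ t ∈ ball (0 : ℂ) (1 / 2), z₀ * (1 + t) ^ (κ : ℂ) ∈ U) :
    ∃ s' q' : ℂ → ℂ, SolvesLiouville
      (fun t => φ (z₀ * (1 + t) ^ (κ : ℂ)) * (‖1 + t‖ ^ (1 - κ) / (‖z₀‖ * |κ|))) s' q'
        (ball 0 (1 / 2)) ∧
      s' 0 = (s z₀ * (z₀ * κ) + φ z₀ * ((1 - κ) / 2)) * (1 / (‖z₀‖ * |κ|) : ℝ) ∧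
      q' 0 = q z₀ * (z₀ * κ) ^ 2 + (1 - κ ^ 2) / 2 := by
  set C : ℝ := Real.sqrt (1 / (‖z₀‖ * |κ|)) with hC
  have hpos : 0 < ‖z₀‖ * |κ| := mul_pos (norm_pos_iff.2 hz₀) (abs_pos.2 hκ)
  have hC2 : C ^ 2 = 1 / (‖z₀‖ * |κ|) := Real.sq_sqrt (by positivity)
  have hC0 : (C : ℂ) ≠ 0 := by
    have : 0 < C := Real.sqrt_pos.2 (by positivity)
    exact_mod_cast this.ne'
  set σ : ℝ := (1 - κ) / 2 with hσ
  have hx : ∀ t ∈ ball (0 : ℂ) (1 / 2), ‖t‖ < 1 := fun t ht => by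
    rw [mem_ball_zero_iff] at ht; linarith
  have hx0 : ∀ t ∈ ball (0 : ℂ) (1 / 2), 1 + t ≠ 0 := fun t ht =>
    Complex.slitPlane_ne_zero (Complex.mem_slitPlane_of_norm_lt_one (hx t ht))
  have hd1 : ∀ t ∈ ball (0 : ℂ) (1 / 2), HasDerivAt (fun t : ℂ => 1 + t) 1 t :=
    fun t _ => (hasDerivAt_id t).const_add 1
  have hP := fun (c : ℂ) (t : ℂ) (ht : t ∈ ball (0 : ℂ) (1 / 2)) =>
    hasDerivAt_one_add_cpow c (hx t ht)
  have main := h.pullback (V := ball 0 (1 / 2)) isOpen_ball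
    (η := fun t => z₀ * (1 + t) ^ (κ : ℂ)) (η' := fun t => z₀ * (κ * (1 + t) ^ (κ : ℂ) / (1 + t)))
    (η'' := fun t => z₀ * (κ * (κ - 1) * (1 + t) ^ (κ : ℂ) / (1 + t) ^ 2))
    (ℓ := fun t => C * (1 + t) ^ (σ : ℂ)) (ℓ' := fun t => C * (σ * (1 + t) ^ (σ : ℂ) / (1 + t)))
    (ℓ'' := fun t => C * (σ * (σ - 1) * (1 + t) ^ (σ : ℂ) / (1 + t) ^ 2))
    (fun t ht => (hP κ t ht).const_mul z₀)
    (fun t ht => ((((hP κ t ht).const_mul (κ : ℂ)).div (hd1 t ht) (hx0 t ht)).const_mul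
      z₀).congr_deriv (by
        have := hx0 t ht
        field_simp))
    (fun t ht => (hP σ t ht).const_mul (C : ℂ))
    (fun t ht => ((((hP σ t ht).const_mul (σ : ℂ)).div (hd1 t ht) (hx0 t ht)).const_mul
      (C : ℂ)).congr_deriv (by
        have := hx0 t ht
        field_simp))
    (fun t ht => by
      have h1 := (hP σ t ht).differentiableAt
      have h2 := (hd1 t ht).differentiableAt
      exact (((h1.const_mul _).div (h2.pow 2) (pow_ne_zero 2 (hx0 t ht))).const_mul
        _).differentiableWithinAt)
    hmaps
    (fun t ht => by
      have := hx0 t ht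
      have e : (σ : ℂ) = (1 - κ) / 2 := by rw [hσ]; push_cast; ring
      rw [e]
      field_simp
      ring)
    (fun t ht => by
      have h0 := norm_pos_iff.2 (hx0 t ht)
      rw [norm_sq_eq, norm_sq_eq]
      norm_cast
      simp only [norm_mul, norm_div, Complex.norm_cpow_real, Complex.norm_real, Real.norm_eq_abs]
      have e1 : (|C| * ‖1 + t‖ ^ σ) ^ 2 = C ^ 2 * ‖1 + t‖ ^ (1 - κ) := by
        rw [mul_pow, sq_abs, ← Real.rpow_natCast (‖1 + t‖ ^ σ) 2, ← Real.rpow_mul h0.le, hσ]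
        congr 2
        push_cast
        ring
      rw [e1, hC2, Real.rpow_sub h0, Real.rpow_one]
      have := Real.rpow_pos_of_pos h0 κ
      have hz := norm_pos_iff.2 hz₀
      have hk := abs_pos.2 hκ
      field_simp)
  have hσc : (σ : ℂ) = (1 - κ) / 2 := by rw [hσ]; push_cast; ring
  have hφ : ∀ t ∈ ball (0 : ℂ) (1 / 2), ‖(C : ℂ) * (1 + t) ^ (σ : ℂ)‖ ^ 2 =
      ‖1 + t‖ ^ (1 - κ) / (‖z₀‖ * |κ|) := by
    intro t ht
    rw [norm_mul, Complex.norm_cpow_real, Complex.norm_real, mul_pow, Real.norm_eq_abs, sq_abs, hC2,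
      ← Real.rpow_natCast (‖1 + t‖ ^ σ) 2, ← Real.rpow_mul (norm_nonneg _), hσ]
    push_cast
    rw [div_mul_cancel₀ _ (two_ne_zero)]
    ring
  refine ⟨_, _, main.congr fun t ht => by rw [hφ t ht], ?_, ?_⟩
  · simp only [add_zero, Complex.one_cpow, mul_one, div_one, Complex.conj_ofReal]
    rw [← hC2, hσc]
    push_cast
    ring
  · simp only [add_zero, Complex.one_cpow, mul_one, div_one, one_pow]
    rw [hσc]
    field_simp
    ring

/-- A filter on the plane that is stable under bounded changes of the modulus. -/
def ModulusStable (l : Filter ℂ) : Prop :=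
  ∀ K : ℝ, 1 ≤ K → ∀ S ∈ l, ∀ᶠ z₀ in l, ∀ z : ℂ, ‖z₀‖ / K ≤ ‖z‖ → ‖z‖ ≤ K * ‖z₀‖ → z ∈ S

lemma modulusStable_nhdsNE_zero : ModulusStable (𝓝[≠] (0 : ℂ)) := by
  intro K hK S hS
  obtain ⟨δ, hδ, hS⟩ := Metric.mem_nhdsWithin_iff.1 hS
  have hK0 : 0 < K := by linarith
  have : ball (0 : ℂ) (δ / K) ∩ {0}ᶜ ∈ 𝓝[≠] (0 : ℂ) :=
    Metric.mem_nhdsWithin_iff.2 ⟨δ / K, by positivity, subset_rfl⟩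
  filter_upwards [this] with z₀ hz₀ z h1 h2
  have h3 : ‖z₀‖ < δ / K := by simpa using hz₀.1
  have h4 : 0 < ‖z₀‖ := norm_pos_iff.2 hz₀.2
  apply hS
  constructor
  · rw [mem_ball_zero_iff]
    rw [lt_div_iff₀ hK0] at h3
    linarith
  · have : 0 < ‖z‖ := lt_of_lt_of_le (by positivity) h1
    exact norm_pos_iff.1 this

lemma modulusStable_cocompact : ModulusStable (cocompact ℂ) := by
  intro K hK S hS
  have hK0 : 0 < K := by linarith
  rw [← Metric.cobounded_eq_cocompact] at hS ⊢
  obtain ⟨r, -, hr⟩ := (hasBasis_cobounded_norm (E := ℂ)).mem_iff.1 hS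
  have : {z : ℂ | K * r ≤ ‖z‖} ∈ Bornology.cobounded ℂ :=
    hasBasis_cobounded_norm.mem_of_mem trivial
  filter_upwards [this] with z₀ hz₀ z h1 _
  apply hr
  refine le_trans ?_ h1
  rw [le_div_iff₀ hK0]
  simpa [mul_comm] using hz₀

/-- First order asymptotics at a conical point, from the leading asymptotics of the density
alone: the metric is nearly flat in the coordinate of `pullback_cpow`, where `local_estimate`
applies. -/
theorem tendsto_of_conical (h : SolvesLiouville φ s q U) {l : Filter ℂ} (hl : ModulusStable l)
    (hl0 : ∀ᶠ z in l, z ≠ 0) (hU : U ∈ l) {α C : ℝ} (hα : α ≠ 0) (hC : 0 < C)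
    (hφ : Tendsto (fun z => φ z * ‖z‖ ^ (α - 1)) l (𝓝 C)) :
    Tendsto (fun z => z * (s z / φ z)) l (𝓝 ((1 - α) / 2)) ∧
      Tendsto (fun z => z ^ 2 * q z) l (𝓝 ((1 - α ^ 2) / 2)) := by
  have key : ∀ ε : ℝ, 0 < ε → ε ≤ 1 / 2 → ∀ᶠ z in l,
      ‖z * (s z / φ z) - (1 - α) / 2‖ ^ 2 ≤ |α| ^ 2 * (2 ^ 18 * ε) ∧
      ‖z ^ 2 * q z - (1 - α ^ 2) / 2‖ ^ 2 ≤ |α| ^ 4 * (2 ^ 18 * ε) := by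
    intro ε hε hε2
    set κ := α⁻¹ with hκ
    have hκ0 : κ ≠ 0 := inv_ne_zero hα
    set K : ℝ := 2 ^ |κ| with hK
    have hK1 : 1 ≤ K := Real.one_le_rpow (by norm_num) (abs_nonneg _)
    have hS : {z | z ∈ U ∧ z ≠ 0 ∧ |φ z * ‖z‖ ^ (α - 1) - C| < ε / 4 * C} ∈ l := by
      filter_upwards [hU, hl0, hφ (Metric.ball_mem_nhds C (show 0 < ε / 4 * C by positivity))]
        with z h1 h2 h3
      exact ⟨h1, h2, h3⟩
    filter_upwards [hl K hK1 _ hS] with z₀ hz₀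
    have hz00 := hz₀ z₀ (div_le_self (norm_nonneg _) hK1)
      (le_mul_of_one_le_left (norm_nonneg _) hK1)
    have hzpos := norm_pos_iff.2 hz00.2.1
    have hx : ∀ t ∈ ball (0 : ℂ) (1 / 2), 1 / 2 ≤ ‖1 + t‖ ∧ ‖1 + t‖ ≤ 2 := by
      intro t ht
      rw [mem_ball_zero_iff] at ht
      have h1 := norm_sub_le (1 + t) t
      have h2 := norm_add_le 1 t
      simp only [add_sub_cancel_right, norm_one] at h1 h2
      constructor <;> linarith
    have hη : ∀ t ∈ ball (0 : ℂ) (1 / 2), z₀ * (1 + t) ^ (κ : ℂ) ∈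
        {z | z ∈ U ∧ z ≠ 0 ∧ |φ z * ‖z‖ ^ (α - 1) - C| < ε / 4 * C} := by
      intro t ht
      obtain ⟨h1, h2⟩ := hx t ht
      have hpos : 0 < ‖1 + t‖ := by linarith
      have hb : ‖1 + t‖ ^ κ ≤ K ∧ K⁻¹ ≤ ‖1 + t‖ ^ κ := by
        have hl : |Real.log ‖1 + t‖| ≤ Real.log 2 := by
          rw [abs_le]
          constructor
          · rw [← Real.log_inv]
            exact Real.log_le_log (by norm_num) (by linarith)
          · exact Real.log_le_log hpos h2
        have hm : |Real.log ‖1 + t‖ * κ| ≤ Real.log 2 * |κ| := by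
          rw [abs_mul]
          exact mul_le_mul_of_nonneg_right hl (abs_nonneg _)
        rw [hK, ← Real.rpow_neg (by norm_num), Real.rpow_def_of_pos hpos,
          Real.rpow_def_of_pos two_pos, Real.rpow_def_of_pos two_pos, Real.exp_le_exp,
          Real.exp_le_exp]
        constructor
        · exact (abs_le.1 hm).2
        · linarith [(abs_le.1 hm).1]
      apply hz₀ <;> rw [norm_mul, Complex.norm_cpow_real]
      · rw [div_eq_mul_inv]
        exact mul_le_mul_of_nonneg_left hb.2 hzpos.le
      · rw [mul_comm]
        exact mul_le_mul_of_nonneg_right hb.1 hzpos.le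
    obtain ⟨s', q', h', hs', hq'⟩ := h.pullback_cpow hz00.2.1 hκ0 (fun t ht => (hη t ht).1)
    have hφ' : ∀ t ∈ ball (0 : ℂ) (1 / 2),
        φ (z₀ * (1 + t) ^ (κ : ℂ)) * (‖1 + t‖ ^ (1 - κ) / (‖z₀‖ * |κ|)) =
        (φ (z₀ * (1 + t) ^ (κ : ℂ)) * ‖z₀ * (1 + t) ^ (κ : ℂ)‖ ^ (α - 1)) *
          (‖z₀‖ ^ (-α) / |κ|) := by
      intro t ht
      have hpos : 0 < ‖1 + t‖ := by linarith [(hx t ht).1]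
      rw [norm_mul, Complex.norm_cpow_real, Real.mul_rpow hzpos.le (by positivity),
        ← Real.rpow_mul hpos.le]
      have e1 : κ * (α - 1) = 1 - κ := by rw [hκ]; field_simp
      rw [e1, Real.rpow_sub_one hzpos.ne', Real.rpow_neg hzpos.le]
      have := Real.rpow_pos_of_pos hzpos α
      have := abs_pos.2 hκ0
      field_simp
    have h0 : (0 : ℂ) ∈ ball (0 : ℂ) (1 / 2) := mem_ball_self (by norm_num)
    have est := h'.local_estimate hε2 (fun t ht => by
      rw [hφ' t ht, hφ' 0 h0]
      simp only [add_zero, Complex.one_cpow, mul_one]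
      have hpos : 0 < ‖z₀‖ ^ (-α) / |κ| :=
        div_pos (Real.rpow_pos_of_pos hzpos _) (abs_pos.2 hκ0)
      rw [← sub_mul, abs_mul, abs_of_pos hpos, ← mul_assoc]
      refine mul_le_mul_of_nonneg_right ?_ hpos.le
      have h1 := (abs_lt.1 (hη t ht).2.2)
      have h2 := (abs_lt.1 hz00.2.2)
      rw [abs_le]
      constructor <;> nlinarith)
    have hφz : (φ z₀ : ℂ) ≠ 0 := h.ofReal_ne_zero hz00.1
    have hαc : (α : ℂ) ≠ 0 := by exact_mod_cast hα
    rw [hq'] at est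
    simp only [hs', add_zero, Complex.one_cpow, mul_one, norm_one, Real.one_rpow] at est
    constructor
    · have e : z₀ * (s z₀ / φ z₀) - (1 - α) / 2 =
          α * ((s z₀ * (z₀ * κ) + φ z₀ * ((1 - κ) / 2)) * (1 / (‖z₀‖ * |κ|) : ℝ) /
            (φ z₀ * (1 / (‖z₀‖ * |κ|)) : ℝ)) := by
        have hc : ((1 / (‖z₀‖ * |κ|) : ℝ) : ℂ) ≠ 0 := by
          have := abs_pos.2 hκ0
          exact_mod_cast (by positivity : (1 / (‖z₀‖ * |κ|) : ℝ) ≠ 0)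
        rw [Complex.ofReal_mul, mul_div_mul_right _ _ hc, hκ]
        push_cast
        field_simp
        ring
      rw [e, norm_mul, mul_pow, Complex.norm_real, Real.norm_eq_abs]
      exact mul_le_mul_of_nonneg_left est.1 (by positivity)
    · have e : z₀ ^ 2 * q z₀ - (1 - α ^ 2) / 2 =
          α ^ 2 * (q z₀ * (z₀ * κ) ^ 2 + (1 - κ ^ 2) / 2) := by
        rw [hκ]
        push_cast
        field_simp
        ring
      rw [e, norm_mul, mul_pow, norm_pow, Complex.norm_real, Real.norm_eq_abs, ← pow_mul]
      exact mul_le_mul_of_nonneg_left est.2 (by positivity)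
  have lim : ∀ {f : ℂ → ℂ} {L : ℂ} {M : ℝ}, 0 ≤ M →
      (∀ ε : ℝ, 0 < ε → ε ≤ 1 / 2 → ∀ᶠ z in l, ‖f z - L‖ ^ 2 ≤ M * (2 ^ 18 * ε)) →
      Tendsto f l (𝓝 L) := by
    intro f L M hM H
    rw [Metric.tendsto_nhds]
    intro δ hδ
    set ε := min (1 / 2) (δ ^ 2 / (2 ^ 19 * (M + 1))) with hε
    have hε0 : 0 < ε := lt_min (by norm_num) (by positivity)
    filter_upwards [H ε hε0 (min_le_left _ _)] with z hz
    rw [dist_eq_norm]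
    have h1 : ε ≤ δ ^ 2 / (2 ^ 19 * (M + 1)) := min_le_right _ _
    rw [le_div_iff₀ (by positivity)] at h1
    have : ‖f z - L‖ ^ 2 < δ ^ 2 := by nlinarith [sq_pos_of_pos hδ]
    exact lt_of_pow_lt_pow_left₀ 2 hδ.le this
  exact ⟨lim (by positivity) fun ε h1 h2 => (key ε h1 h2).mono fun z hz => hz.1,
    lim (by positivity) fun ε h1 h2 => (key ε h1 h2).mono fun z hz => hz.2⟩

end SolvesLiouville

/-! ### Quadratic differentials on the thrice punctured sphere -/

/-- A holomorphic function on `ℂ ∖ {0, 1}` with at most double poles at `0` and `1` that is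
`O(z⁻²)` at infinity is determined by the three leading coefficients. -/
lemma eq_of_double_poles {q : ℂ → ℂ} {a₀ a₁ a₂ : ℂ} (hq : DifferentiableOn ℂ q {0, 1}ᶜ)
    (h₀ : Tendsto (fun z => z ^ 2 * q z) (𝓝[≠] 0) (𝓝 a₀))
    (h₁ : Tendsto (fun z => (z - 1) ^ 2 * q z) (𝓝[≠] 1) (𝓝 a₁))
    (h₂ : Tendsto (fun z => z ^ 2 * q z) (cocompact ℂ) (𝓝 a₂)) {z : ℂ}
    (hz : z ∈ ({0, 1}ᶜ : Set ℂ)) :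
    q z * (z ^ 2 * (z - 1) ^ 2) = a₀ * (1 - z) + a₁ * z + a₂ * (z * (z - 1)) := by
  set P : ℂ → ℂ := fun z => a₀ * (1 - z) + a₁ * z + a₂ * (z * (z - 1)) with hP
  have hPd : Differentiable ℂ P := by fun_prop
  set F₀ : ℂ → ℂ := fun z => q z * (z ^ 2 * (z - 1) ^ 2) - P z with hF₀
  set F : ℂ → ℂ := fun z => if z ∈ ({0, 1}ᶜ : Set ℂ) then F₀ z else 0 with hF
  have hopen : IsOpen ({0, 1}ᶜ : Set ℂ) := (Set.toFinite {(0 : ℂ), 1}).isClosed.isOpen_compl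
  have hFe : ∀ z ∈ ({0, 1}ᶜ : Set ℂ), F =ᶠ[𝓝 z] F₀ := fun z hz => by
    filter_upwards [hopen.mem_nhds hz] with w hw
    simp only [hF, if_pos hw]
  have hFd0 : ∀ z ∈ ({0, 1}ᶜ : Set ℂ), DifferentiableAt ℂ F z := fun z hz => by
    refine DifferentiableAt.congr_of_eventuallyEq ?_ (hFe z hz)
    have := hq.differentiableAt (hopen.mem_nhds hz)
    have h2 := hPd z
    fun_prop
  have hF00 : F 0 = 0 := by simp [hF]
  have hF01 : F 1 = 0 := by simp [hF]
  have hsing : ∀ p : ℂ, p = 0 ∨ p = 1 → ContinuousAt F p → AnalyticAt ℂ F p := by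
    intro p hp hc
    refine Complex.analyticAt_of_differentiable_on_punctured_nhds_of_continuousAt ?_ hc
    rcases hp with rfl | rfl
    · filter_upwards [self_mem_nhdsWithin,
        nhdsWithin_le_nhds (isOpen_compl_singleton.mem_nhds (zero_ne_one (α := ℂ)))] with w h1 h2
      exact hFd0 w (by simp only [mem_compl_iff, mem_insert_iff, mem_singleton_iff] at *; tauto)
    · filter_upwards [self_mem_nhdsWithin,
        nhdsWithin_le_nhds (isOpen_compl_singleton.mem_nhds (one_ne_zero (α := ℂ)))] with w h1 h2
      exact hFd0 w (by simp only [mem_compl_iff, mem_insert_iff, mem_singleton_iff] at *; tauto)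
  have hsmall : ∀ p : ℂ, (F p = 0) → Tendsto F₀ (𝓝[≠] p) (𝓝 0) → ContinuousAt F p := by
    intro p h0 ht
    rw [continuousAt_iff_punctured_nhds, h0]
    refine squeeze_zero_norm' (Eventually.of_forall fun w => ?_) (tendsto_norm_zero.comp ht)
    by_cases hw : w ∈ ({0, 1}ᶜ : Set ℂ)
    · simp only [hF, if_pos hw, Function.comp, le_refl]
    · simp only [hF, if_neg hw, norm_zero, Function.comp, norm_nonneg]
  have hFd : Differentiable ℂ F := by
    intro w
    by_cases hw : w ∈ ({0, 1}ᶜ : Set ℂ)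
    · exact hFd0 w hw
    · have hw' : w = 0 ∨ w = 1 := by
        simpa only [mem_compl_iff, mem_insert_iff, mem_singleton_iff, not_not] using hw
      refine (hsing w hw' (hsmall w (by rcases hw' with rfl | rfl <;> assumption) ?_)
        ).differentiableAt
      have hc : ∀ p : ℂ, Tendsto (fun z : ℂ => z) (𝓝[≠] p) (𝓝 p) :=
        fun p => tendsto_id.mono_left nhdsWithin_le_nhds
      have hc' : Tendsto P (𝓝[≠] w) (𝓝 (P w)) :=
        (hPd w).continuousAt.tendsto.mono_left nhdsWithin_le_nhds
      rcases hw' with rfl | rfl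
      · have := (h₀.mul (((hc 0).sub_const 1).pow 2)).sub hc'
        simp only [hP] at this
        ring_nf at this
        refine this.congr fun w => ?_
        simp only [hF₀, hP]; ring
      · have := (h₁.mul ((hc 1).pow 2)).sub hc'
        simp only [hP] at this
        ring_nf at this
        refine this.congr fun w => ?_
        simp only [hF₀, hP]; ring
  set G : ℂ → ℂ := dslope (dslope F 0) 1 with hG
  have hGd : Differentiable ℂ G := by
    rw [← differentiableOn_univ, hG, Complex.differentiableOn_dslope univ_mem,
      Complex.differentiableOn_dslope univ_mem]
    exact hFd.differentiableOn
  have hGe : ∀ z ∈ ({0, 1}ᶜ : Set ℂ), G z = F₀ z / (z * (z - 1)) := by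
    intro z hz
    have hz' : z ≠ 0 ∧ z ≠ 1 := by
      simpa only [mem_compl_iff, mem_insert_iff, mem_singleton_iff, not_or] using hz
    have hz1 := sub_ne_zero.2 hz'.2
    have hz0 := hz'.1
    rw [hG, dslope_of_ne _ hz'.2, slope_def_field, dslope_of_ne _ hz'.1,
      dslope_of_ne _ one_ne_zero, slope_def_field, slope_def_field, hF01, hF00,
      (hFe z hz).self_of_nhds]
    simp only [sub_zero, zero_div]
    field_simp
  have hne : ∀ᶠ z in cocompact ℂ, z ∈ ({0, 1}ᶜ : Set ℂ) :=
    (Set.toFinite {(0 : ℂ), 1}).isCompact.compl_mem_cocompact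
  have hinv : Tendsto (fun z : ℂ => z⁻¹) (cocompact ℂ) (𝓝 0) := by
    rw [← Metric.cobounded_eq_cocompact]
    exact tendsto_inv₀_cobounded
  have hGlim : Tendsto G (cocompact ℂ) (𝓝 0) := by
    have h1 : Tendsto (fun z : ℂ => z ^ 2 * q z * (1 - z⁻¹) -
        (a₀ * (z⁻¹ - 1) + a₁) * z⁻¹ * (1 - z⁻¹)⁻¹ - a₂) (cocompact ℂ)
        (𝓝 (a₂ * (1 - 0) - (a₀ * (0 - 1) + a₁) * 0 * (1 - 0)⁻¹ - a₂)) :=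
      ((h₂.mul (hinv.const_sub 1)).sub (((((hinv.sub_const 1).const_mul a₀).add_const a₁).mul
        hinv).mul ((hinv.const_sub 1).inv₀ (by simp)))).sub_const a₂
    have e : a₂ * (1 - 0) - (a₀ * (0 - 1) + a₁) * 0 * (1 - 0)⁻¹ - a₂ = 0 := by ring
    rw [e] at h1
    refine h1.congr' ?_
    filter_upwards [hne] with z hz
    have hz' : z ≠ 0 ∧ z ≠ 1 := by
      simpa only [mem_compl_iff, mem_insert_iff, mem_singleton_iff, not_or] using hz
    have hz1 := sub_ne_zero.2 hz'.2
    have hz0 := hz'.1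
    have e2 : (1 - z⁻¹)⁻¹ = z / (z - 1) := by
      have : 1 - z⁻¹ = (z - 1) / z := by field_simp
      rw [this, inv_div]
    rw [hGe z hz, e2]
    simp only [hF₀, hP]
    field_simp
    ring
  have hG0 : G z = 0 := hGd.apply_eq_of_tendsto_cocompact z hGlim
  have hz' : z ≠ 0 ∧ z ≠ 1 := by
    simpa only [mem_compl_iff, mem_insert_iff, mem_singleton_iff, not_or] using hz
  rw [hGe z hz, div_eq_zero_iff] at hG0
  have := hG0.resolve_right (mul_ne_zero hz'.1 (sub_ne_zero.2 hz'.2))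
  exact sub_eq_zero.1 this

/-! ### Absence of a logarithm at a cone of angle `4π` -/

namespace SolvesLiouville

variable {φ : ℂ → ℝ} {s q : ℂ → ℂ} {U V : Set ℂ}

/-- At a conical point of order one the projective connection
`q = -3 / (2 z²) + q₁ / z + q₀ + ⋯` satisfies `q₀ = -q₁² / 2`: this is the condition that the
equation `y'' + (q / 2) y = 0` has no logarithmic solutions. With `p = ∂ log (ρ / |z|²)`, the
function `F = (p + q₁) / z` satisfies `∂F = (q₀ + p² / 2 + o(1)) / z` and `∂̄F = O(|z|)`. A growth
estimate along rays gives `p → -q₁`, and integrating `dF` over small circles gives the result. -/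
theorem no_log (h : SolvesLiouville φ s q U) (hU : U ∈ 𝓝[≠] (0 : ℂ)) {C : ℝ} (hC : 0 < C)
    (hφ : Tendsto (fun z => φ z * ‖z‖) (𝓝[≠] 0) (𝓝 C)) {q₀ q₁ : ℂ}
    (hq : Tendsto (fun z => q z + 3 / (2 * z ^ 2) - q₁ / z) (𝓝[≠] 0) (𝓝 q₀)) :
    q₀ + q₁ ^ 2 / 2 = 0 := by
  set r : ℂ → ℂ := fun z => q z + 3 / (2 * z ^ 2) - q₁ / z with hr
  set p : ℂ → ℂ := fun z => -2 * (s z / φ z) - 1 / z with hp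
  set F : ℂ → ℂ := fun z => (p z + q₁) / z with hF
  set a : ℂ → ℂ := fun z => (r z + p z ^ 2 / 2) / z with ha
  set b : ℂ → ℂ := fun z => -1 / (2 * (φ z : ℂ) ^ 2 * z) with hb
  have hFW : ∀ z ∈ U, z ≠ 0 → HasWirtinger F (a z) (b z) z := by
    intro z hz hz0
    have h0 := h.ofReal_ne_zero hz
    have e1 := ((h.hasWirtinger_deriv z hz).div (h.hasWirtinger z hz) h0).const_mul (-2)
    have e2 := (HasWirtinger.const 1 z).div (HasWirtinger.id z) hz0
    refine (((e1.sub e2).add (HasWirtinger.const q₁ z)).div (HasWirtinger.id z)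
      hz0).congr_coeff ?_ ?_
    · simp only [ha, hr, hp]
      field_simp
      ring
    · simp only [hb]
      field_simp
      ring
  have hzid : Tendsto (fun z : ℂ => z) (𝓝[≠] 0) (𝓝 0) := tendsto_id.mono_left nhdsWithin_le_nhds
  have hzp : Tendsto (fun z => z * p z) (𝓝[≠] 0) (𝓝 0) := by
    have := (h.tendsto_of_conical modulusStable_nhdsNE_zero self_mem_nhdsWithin hU two_ne_zero hC
      (by norm_num; exact hφ)).1
    have h2 := (this.const_mul (-2)).sub_const 1
    have e : (-2 : ℂ) * ((1 - (2 : ℝ)) / 2) - 1 = 0 := by push_cast; norm_num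
    rw [e] at h2
    refine h2.congr' ?_
    filter_upwards [self_mem_nhdsWithin] with z hz
    have hz0 : z ≠ 0 := hz
    simp only [hp]
    field_simp
  have hφinv : Tendsto (fun z => 1 / (2 * φ z ^ 2)) (𝓝[≠] 0) (𝓝 0) := by
    have h1 : Tendsto (fun z : ℂ => ‖z‖ ^ 2 / (2 * (φ z * ‖z‖) ^ 2)) (𝓝[≠] 0)
        (𝓝 (‖(0 : ℂ)‖ ^ 2 / (2 * C ^ 2))) :=
      (hzid.norm.pow 2).div ((hφ.pow 2).const_mul 2) (by positivity)
    simp only [norm_zero, ne_eq, OfNat.ofNat_ne_zero, not_false_eq_true, zero_pow, zero_div] at h1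
    refine h1.congr' ?_
    filter_upwards [self_mem_nhdsWithin, hU] with z hz hzU
    have := norm_pos_iff.2 (show z ≠ 0 from hz)
    have := h.pos z hzU
    field_simp
  set M : ℝ := ‖q₀‖ + 1 + ‖q₁‖ ^ 2 / 2 + 1 with hM
  have hgood : {z : ℂ | z ∈ U ∧ ‖z * p z‖ < 1 / 8 ∧ ‖z‖ * ‖q₁‖ < 1 / 8 ∧ ‖r z‖ < ‖q₀‖ + 1 ∧
      1 / (2 * φ z ^ 2) < 1} ∈ 𝓝[≠] (0 : ℂ) := by
    have t1 : Tendsto (fun z => ‖z * p z‖) (𝓝[≠] 0) (𝓝 0) := by simpa using hzp.norm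
    have t2 : Tendsto (fun z : ℂ => ‖z‖ * ‖q₁‖) (𝓝[≠] 0) (𝓝 0) := by
      simpa using hzid.norm.mul_const ‖q₁‖
    filter_upwards [hU, t1.eventually_lt_const (show (0 : ℝ) < 1 / 8 by norm_num),
      t2.eventually_lt_const (show (0 : ℝ) < 1 / 8 by norm_num),
      hq.norm.eventually_lt_const (show ‖q₀‖ < ‖q₀‖ + 1 by linarith),
      hφinv.eventually_lt_const one_pos] with z h1 h2 h3 h4 h5
    exact ⟨h1, h2, h3, h4, h5⟩
  obtain ⟨R, hR, hRsub⟩ := Metric.mem_nhdsWithin_iff.1 hgood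
  have good : ∀ z : ℂ, z ≠ 0 → ‖z‖ < R → z ∈ U ∧ ‖z * p z‖ < 1 / 8 ∧ ‖z‖ * ‖q₁‖ < 1 / 8 ∧
      ‖r z‖ < ‖q₀‖ + 1 ∧ 1 / (2 * φ z ^ 2) < 1 := fun z h1 h2 =>
    hRsub ⟨by simpa using h2, h1⟩
  set r₀ := R / 2 with hr₀
  have hr₀0 : 0 < r₀ := by positivity
  -- `‖dF/dx‖ ≤ M + ‖F‖ / 8` along the ray `ω e⁻ˣ` keeps `‖F‖` below a multiple of `e^(x/2)`,
  -- that is, `F = O(|z|^(-1/2))`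
  obtain ⟨A, hA⟩ : ∃ A : ℝ, ∀ z : ℂ, z ≠ 0 → ‖z‖ ≤ r₀ → ‖F z‖ ≤ A * Real.sqrt (r₀ / ‖z‖) := by
    obtain ⟨B, hB⟩ := (isCompact_sphere (0 : ℂ) r₀).exists_bound_of_continuousOn (f := F)
      (fun z hz => by
        have hz' : ‖z‖ = r₀ := by simpa using hz
        have hz0 : z ≠ 0 := norm_pos_iff.1 (by rw [hz']; exact hr₀0)
        exact (hFW z (good z hz0 (by linarith)).1 hz0).continuousAt.continuousWithinAt)
    refine ⟨max B (3 * M), fun z hz0 hz => ?_⟩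
    have hzpos := norm_pos_iff.2 hz0
    set ω : ℂ := (r₀ / ‖z‖ : ℝ) * z with hω
    have hωn : ‖ω‖ = r₀ := by
      rw [hω, norm_mul, Complex.norm_real, Real.norm_of_nonneg (by positivity)]
      field_simp
    have hω0 : ω ≠ 0 := norm_pos_iff.1 (by rw [hωn]; exact hr₀0)
    set γ : ℝ → ℂ := fun x => ω * Real.exp (-x) with hγ
    have hγn : ∀ x, ‖γ x‖ = r₀ * Real.exp (-x) := fun x => by
      rw [hγ, norm_mul, hωn, Complex.norm_real, Real.norm_of_nonneg (Real.exp_pos _).le]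
    have hγ0 : ∀ x, γ x ≠ 0 := fun x => mul_ne_zero hω0 (by exact_mod_cast (Real.exp_pos _).ne')
    have hγd : ∀ x, HasDerivAt γ (-γ x) x := fun x => by
      have := ((((hasDerivAt_id x).neg).exp).ofReal_comp).const_mul ω
      refine this.congr_deriv ?_
      simp [hγ]
    have hγlt : ∀ x, 0 ≤ x → ‖γ x‖ < R := fun x hx => by
      rw [hγn]
      have := Real.exp_le_one_iff.2 (neg_nonpos.2 hx)
      nlinarith
    have hd : ∀ x, 0 ≤ x → HasDerivAt (fun x => F (γ x))
        (a (γ x) * (-γ x) + b (γ x) * conj (-γ x)) x :=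
      fun x hx => (hFW (γ x) (good _ (hγ0 x) (hγlt x hx)).1 (hγ0 x)).comp_curve (hγd x)
    have hbd : ∀ x, 0 ≤ x → ‖a (γ x) * (-γ x) + b (γ x) * conj (-γ x)‖ ≤ M + ‖F (γ x)‖ / 8 := by
      intro x hx
      obtain ⟨g1, g2, g3, g4, g5⟩ := good _ (hγ0 x) (hγlt x hx)
      have hφ0 := h.pos _ g1
      have n1 : ‖a (γ x) * (-γ x)‖ ≤ ‖r (γ x)‖ + ‖p (γ x)‖ ^ 2 / 2 := by
        have : a (γ x) * (-γ x) = -(r (γ x) + p (γ x) ^ 2 / 2) := by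
          simp only [ha]
          have := hγ0 x
          field_simp
        rw [this, norm_neg]
        refine (norm_add_le _ _).trans ?_
        simp
      have n2 : ‖b (γ x) * conj (-γ x)‖ ≤ 1 := by
        have : ‖b (γ x) * conj (-γ x)‖ = 1 / (2 * φ (γ x) ^ 2) := by
          simp only [hb, norm_mul, norm_div, norm_neg, norm_one, map_neg, RCLike.norm_conj,
            norm_pow,
            Complex.norm_real, Real.norm_of_nonneg hφ0.le, Complex.norm_ofNat]
          have := norm_pos_iff.2 (hγ0 x)
          field_simp
        rw [this]
        exact g5.le
      have n3 : ‖p (γ x)‖ ≤ ‖γ x‖ * ‖F (γ x)‖ + ‖q₁‖ := by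
        have : p (γ x) = γ x * F (γ x) - q₁ := by
          simp only [hF]
          have := hγ0 x
          field_simp
          ring
        rw [this]
        exact (norm_sub_le _ _).trans (by rw [norm_mul])
      rw [norm_mul] at g2
      have n4 : ‖p (γ x)‖ ^ 2 ≤ ‖F (γ x)‖ / 4 + ‖q₁‖ ^ 2 := by
        have hp0 := norm_nonneg (p (γ x))
        have hF0 := norm_nonneg (F (γ x))
        have hq0 := norm_nonneg q₁
        have k1 : ‖p (γ x)‖ ^ 2 ≤ ‖p (γ x)‖ * (‖γ x‖ * ‖F (γ x)‖ + ‖q₁‖) := by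
          rw [sq]
          exact mul_le_mul_of_nonneg_left n3 hp0
        have k2 : ‖γ x‖ * ‖p (γ x)‖ * ‖F (γ x)‖ ≤ 1 / 8 * ‖F (γ x)‖ :=
          mul_le_mul_of_nonneg_right g2.le hF0
        have k3 : ‖p (γ x)‖ * ‖q₁‖ ≤ (‖γ x‖ * ‖F (γ x)‖ + ‖q₁‖) * ‖q₁‖ :=
          mul_le_mul_of_nonneg_right n3 hq0
        have k4 : ‖γ x‖ * ‖q₁‖ * ‖F (γ x)‖ ≤ 1 / 8 * ‖F (γ x)‖ :=
          mul_le_mul_of_nonneg_right g3.le hF0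
        nlinarith
      refine (norm_add_le _ _).trans ?_
      rw [hM]
      linarith
    set T := Real.log (r₀ / ‖z‖) with hT
    have hT0 : 0 ≤ T := Real.log_nonneg (by rwa [one_le_div hzpos])
    have hexpT : Real.exp T = r₀ / ‖z‖ := Real.exp_log (by positivity)
    have hM0 : 0 < M := by positivity
    have main := image_norm_le_of_norm_deriv_right_lt_deriv_boundary (f := fun x => F (γ x))
      (a := 0) (b := T)
      (f' := fun x => a (γ x) * (-γ x) + b (γ x) * conj (-γ x))
      (fun x hx => (hd x hx.1).continuousAt.continuousWithinAt)
      (fun x hx => (hd x hx.1).hasDerivWithinAt)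
      (B := fun x => max B (3 * M) * Real.exp (x / 2))
      (B' := fun x => max B (3 * M) * (Real.exp (x / 2) * (1 / 2)))
      (by
        simp only [zero_div, Real.exp_zero, mul_one]
        refine (hB (γ 0) ?_).trans (le_max_left _ _)
        rw [mem_sphere_zero_iff_norm, hγn]
        simp)
      (fun x => (((hasDerivAt_id x).div_const 2).exp).const_mul _)
      (fun x hx e => by
        refine (hbd x hx.1).trans_lt ?_
        rw [e]
        have h1 : 1 ≤ Real.exp (x / 2) := Real.one_le_exp (by linarith [hx.1])
        have h2 := le_max_right B (3 * M)
        nlinarith)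
    have := main (right_mem_Icc.2 hT0)
    have hγT : γ T = z := by
      simp only [hγ, hω, Real.exp_neg, hexpT]
      push_cast
      have : (‖z‖ : ℂ) ≠ 0 := by exact_mod_cast hzpos.ne'
      have : (r₀ : ℂ) ≠ 0 := by exact_mod_cast hr₀0.ne'
      field_simp
    simp only [hγT] at this
    refine this.trans (le_of_eq ?_)
    rw [← hexpT, Real.sqrt_eq_rpow, ← Real.exp_mul]
    ring_nf
  have hplim : Tendsto p (𝓝[≠] 0) (𝓝 (-q₁)) := by
    rw [tendsto_iff_norm_sub_tendsto_zero]
    have hs : Tendsto (fun z : ℂ => |A| * Real.sqrt (r₀ * ‖z‖)) (𝓝[≠] 0) (𝓝 0) := by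
      have : Tendsto (fun z : ℂ => |A| * Real.sqrt (r₀ * ‖z‖)) (𝓝[≠] 0)
          (𝓝 (|A| * Real.sqrt (r₀ * ‖(0 : ℂ)‖))) :=
        ((hzid.norm.const_mul r₀).sqrt).const_mul _
      simpa using this
    refine squeeze_zero' (Eventually.of_forall fun z => norm_nonneg _) ?_ hs
    filter_upwards [self_mem_nhdsWithin, mem_nhdsWithin_of_mem_nhds (closedBall_mem_nhds 0 hr₀0)]
      with z hz hzr
    have hz0 : z ≠ 0 := hz
    have hzpos := norm_pos_iff.2 hz0
    have hzr' : ‖z‖ ≤ r₀ := by simpa using hzr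
    have e : p z - -q₁ = z * F z := by
      simp only [hF]
      field_simp
      ring
    have e2 : ‖z‖ * Real.sqrt (r₀ / ‖z‖) = Real.sqrt (r₀ * ‖z‖) := by
      rw [← Real.sqrt_sq hzpos.le, ← Real.sqrt_mul (sq_nonneg _), Real.sqrt_sq hzpos.le]
      congr 1
      field_simp
    rw [e, norm_mul, ← e2]
    have := (hA z hz0 hzr').trans
      (mul_le_mul_of_nonneg_right (le_abs_self A) (Real.sqrt_nonneg _))
    calc _ ≤ ‖z‖ * (|A| * Real.sqrt (r₀ / ‖z‖)) := mul_le_mul_of_nonneg_left this hzpos.le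
      _ = _ := by ring
  -- `F` is single-valued, so `dF` integrates to zero over small circles
  have hg : Tendsto (fun z => a z * z - b z * conj z) (𝓝[≠] 0) (𝓝 (q₀ + q₁ ^ 2 / 2)) := by
    have t1 : Tendsto (fun z => r z + p z ^ 2 / 2) (𝓝[≠] 0) (𝓝 (q₀ + (-q₁) ^ 2 / 2)) :=
      hq.add ((hplim.pow 2).div_const 2)
    have t2 : Tendsto (fun z => b z * conj z) (𝓝[≠] 0) (𝓝 0) := by
      rw [tendsto_zero_iff_norm_tendsto_zero]
      refine hφinv.congr' ?_
      filter_upwards [self_mem_nhdsWithin, hU] with z hz hzU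
      have hz0 := norm_pos_iff.2 (show z ≠ 0 from hz)
      have hφ0 := h.pos z hzU
      simp only [hb, norm_mul, norm_div, norm_neg, norm_one, RCLike.norm_conj, norm_pow,
        Complex.norm_real, Real.norm_of_nonneg hφ0.le, Complex.norm_ofNat]
      field_simp
    have := t1.sub t2
    rw [neg_sq, sub_zero] at this
    refine this.congr' ?_
    filter_upwards [self_mem_nhdsWithin] with z hz
    have hz0 : z ≠ 0 := hz
    simp only [ha]
    field_simp
  by_contra hne
  set L := q₀ + q₁ ^ 2 / 2 with hL
  obtain ⟨R', hR', hsub⟩ := Metric.mem_nhdsWithin_iff.1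
    (hg (Metric.ball_mem_nhds L (show 0 < ‖L‖ / 2 by positivity)))
  set x := min r₀ (R' / 2) with hx
  have hx0 : 0 < x := lt_min hr₀0 (by positivity)
  have hcn : ∀ θ : ℝ, ‖circleMap 0 x θ‖ = x := fun θ => by
    rw [norm_circleMap_zero, abs_of_pos hx0]
  have hc0 : ∀ θ : ℝ, circleMap 0 x θ ≠ 0 := fun θ => circleMap_ne_center hx0.ne'
  have hcU : ∀ θ : ℝ, circleMap 0 x θ ∈ U := fun θ =>
    (good _ (hc0 θ) (by rw [hcn]; exact (min_le_left _ _).trans_lt (by linarith))).1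
  have hcont : ∀ {f : ℂ → ℂ}, ContinuousOn f (U \ {0}) → Continuous fun θ => f (circleMap 0 x θ) :=
    fun hf => continuousOn_univ.1 (hf.comp (continuous_circleMap 0 x).continuousOn
      fun θ _ => ⟨hcU θ, hc0 θ⟩)
  have hφc := h.continuousOn_ofReal.mono (sdiff_subset (t := {0}))
  have hsc := h.continuousOn_deriv.mono (sdiff_subset (t := {0}))
  have hqc := h.differentiableOn.continuousOn.mono (sdiff_subset (t := {0}))
  have hφ0 : ∀ z ∈ U \ {0}, (φ z : ℂ) ≠ 0 := fun z hz => h.ofReal_ne_zero hz.1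
  have hz0 : ∀ z ∈ U \ {0}, z ≠ 0 := fun z hz => hz.2
  have hpc : ContinuousOn p (U \ {0}) :=
    (continuousOn_const.mul (hsc.div hφc hφ0)).sub (continuousOn_const.div continuousOn_id hz0)
  have hrc : ContinuousOn r (U \ {0}) :=
    (hqc.add (continuousOn_const.div (continuousOn_const.mul (continuousOn_id.pow 2))
      fun z hz => mul_ne_zero two_ne_zero (pow_ne_zero 2 (hz0 z hz)))).sub
        (continuousOn_const.div continuousOn_id hz0)
  have hac : ContinuousOn a (U \ {0}) :=
    (hrc.add ((hpc.pow 2).div_const 2)).div continuousOn_id hz0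
  have hbc : ContinuousOn b (U \ {0}) :=
    continuousOn_const.div ((continuousOn_const.mul (hφc.pow 2)).mul continuousOn_id)
      fun z hz => mul_ne_zero (mul_ne_zero two_ne_zero (pow_ne_zero 2 (hφ0 z hz))) (hz0 z hz)
  have int0 := integral_angular_deriv_eq_zero (G := F) (a := a) (b := b) (c := 0) (r := x)
    (fun θ => hFW _ (hcU θ) (hc0 θ)) (hcont hac) (hcont hbc)
  have e : ∀ θ : ℝ, a (circleMap 0 x θ) * (x * Complex.exp (θ * Complex.I)) -
      b (circleMap 0 x θ) * (x * Complex.exp (-(θ * Complex.I))) =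
      (fun z => a z * z - b z * conj z) (circleMap 0 x θ) := fun θ => by
    simp only [circleMap_zero, map_mul, Complex.conj_ofReal, conj_exp_ofReal_mul_I]
  simp only [e] at int0
  have hgc : Continuous fun θ : ℝ => (fun z => a z * z - b z * conj z) (circleMap 0 x θ) :=
    hcont ((hac.mul continuousOn_id).sub (hbc.mul Complex.continuous_conj.continuousOn))
  have bound : ‖∫ θ in (0 : ℝ)..2 * Real.pi,
      ((fun z => a z * z - b z * conj z) (circleMap 0 x θ) - L)‖ ≤
      ‖L‖ / 2 * |2 * Real.pi - 0| := by
    refine intervalIntegral.norm_integral_le_of_norm_le_const fun θ _ => ?_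
    have : circleMap 0 x θ ∈ ball (0 : ℂ) R' ∩ {0}ᶜ := by
      refine ⟨?_, hc0 θ⟩
      rw [mem_ball_zero_iff, hcn]
      exact (min_le_right _ _).trans_lt (by linarith)
    have := hsub this
    rw [mem_preimage, mem_ball, dist_eq_norm] at this
    exact this.le
  rw [intervalIntegral.integral_sub (hgc.intervalIntegrable _ _) (by simp), int0,
    intervalIntegral.integral_const, zero_sub, norm_neg, norm_smul, sub_zero,
    Real.norm_eq_abs] at bound
  have hpi : 0 < |2 * Real.pi| := by positivity
  have hLpos := norm_pos_iff.2 hne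
  nlinarith [mul_pos hpi hLpos]

end SolvesLiouville

/-! ### From curvature to Liouville's equation -/

/-- A smooth solution `u` of `Δu = -2 exp u` gives Liouville data for `exp (-u / 2)`. -/
lemma exists_solvesLiouville {u : ℂ → ℝ} {U : Set ℂ} (hU : IsOpen U)
    (hu : ContDiffOn ℝ ((⊤ : ℕ∞) : WithTop ℕ∞) u U)
    (hΔ : ∀ z ∈ U, Laplacian.laplacian u z = -2 * Real.exp (u z)) :
    ∃ s q : ℂ → ℂ, SolvesLiouville (fun z => Real.exp (-u z / 2)) s q U := by
  set F : ℂ → ℂ := fun z => (u z : ℂ) with hF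
  have hFs : ContDiffOn ℝ ((⊤ : ℕ∞) : WithTop ℕ∞) F U :=
    Complex.ofRealCLM.contDiff.comp_contDiffOn hu
  set v : ℂ → ℂ := dz F with hv
  have hvs := contDiffOn_dz hU hFs
  have hvzs := contDiffOn_dz hU hvs
  have hFv : ∀ z ∈ U, HasWirtinger F (v z) (conj (v z)) z := by
    intro z hz
    have h1 := hFs.hasWirtinger hU hz
    have h2 : HasWirtinger F (conj (dzbar F z)) (conj (dz F z)) z :=
      h1.conjugate.congr_of_eventuallyEq (Eventually.of_forall fun w => by simp [hF])
    exact h1.congr_coeff rfl (h1.unique h2).2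
  have hvbar : ∀ z ∈ U, dzbar v z = -Complex.exp (F z) / 2 := by
    intro z hz
    have h1 := four_mul_dzbar_dz hU hFs hz
    have h2 : Laplacian.laplacian F z = (Laplacian.laplacian u z : ℂ) := by
      have := (((hu.contDiffAt (hU.mem_nhds hz)).of_le
        (show (2 : WithTop ℕ∞) ≤ ((⊤ : ℕ∞) : WithTop ℕ∞) from
          WithTop.coe_le_coe.2 (le_top (a := (2 : ℕ∞))))).laplacian_CLM_comp_left
        (l := Complex.ofRealCLM))
      exact this
    rw [h2, hΔ z hz] at h1
    push_cast at h1
    simp only [hv, hF]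
    linear_combination h1 / 4
  have hvW : ∀ z ∈ U, HasWirtinger v (dz v z) (-Complex.exp (F z) / 2) z := fun z hz =>
    (hvs.hasWirtinger hU hz).congr_coeff rfl (hvbar z hz)
  have hexp : ∀ z ∈ U, HasWirtinger (fun z => Complex.exp (F z)) (Complex.exp (F z) * v z)
      (Complex.exp (F z) * conj (v z)) z := fun z hz =>
    HasWirtinger.comp_left (Complex.hasDerivAt_exp _) (hFv z hz)
  have hcast : ∀ z, ((Real.exp (-u z / 2) : ℝ) : ℂ) = Complex.exp (-1 / 2 * F z) := fun z => by
    push_cast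
    congr 1
    simp only [hF]
    ring
  have hφ : ∀ z ∈ U, HasWirtinger (fun z => ((Real.exp (-u z / 2) : ℝ) : ℂ))
      (-1 / 2 * v z * (Real.exp (-u z / 2) : ℝ)) (conj (-1 / 2 * v z * (Real.exp (-u z / 2) : ℝ)))
      z := by
    intro z hz
    simp only [hcast]
    refine (HasWirtinger.comp_left (Complex.hasDerivAt_exp _)
      ((hFv z hz).const_mul (-1 / 2))).congr_coeff (by ring) ?_
    rw [← hcast]
    simp only [map_mul, Complex.conj_ofReal, map_div₀, map_neg, map_one, map_ofNat]
    ring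
  refine ⟨fun z => -1 / 2 * v z * (Real.exp (-u z / 2) : ℝ), fun z => dz v z - v z ^ 2 / 2, hU,
    fun z _ => Real.exp_pos _, hφ, fun z hz => ?_, fun z hz => ?_⟩
  · have he : Complex.exp (F z) * ((Real.exp (-u z / 2) : ℝ) : ℂ) ^ 2 = 1 := by
      simp only [hF]
      norm_cast
      rw [sq, ← Real.exp_add, ← Real.exp_add]
      ring_nf
      exact Real.exp_zero
    have h0 : ((Real.exp (-u z / 2) : ℝ) : ℂ) ≠ 0 := by exact_mod_cast (Real.exp_pos _).ne'
    refine (((hvW z hz).const_mul (-1 / 2)).mul (hφ z hz)).congr_coeff (by ring) ?_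
    simp only [map_mul, Complex.conj_ofReal, map_div₀, map_neg, map_one, map_ofNat]
    generalize ((Real.exp (-u z / 2) : ℝ) : ℂ) = x at h0 he ⊢
    field_simp
    linear_combination 4 * he
  · have h1 : HasWirtinger (dz v) (dz (dz v) z) (-(Complex.exp (F z) * v z) / 2) z := by
      refine (hvzs.hasWirtinger hU hz).congr_coeff rfl ?_
      rw [dzbar_dz_comm hU hvs hz]
      have e : dzbar v =ᶠ[𝓝 z] fun z => -1 / 2 * Complex.exp (F z) := by
        filter_upwards [hU.mem_nhds hz] with w hw
        rw [hvbar w hw]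
        ring
      have h2 := ((hexp z hz).const_mul (-1 / 2)).congr_of_eventuallyEq e
      have h3 := (contDiffOn_dzbar hU hvs).hasWirtinger hU hz
      rw [(h3.unique h2).1]
      ring
    have h2 : HasWirtinger (fun z => dz v z - v z ^ 2 / 2) (dz (dz v) z - v z * dz v z) 0 z := by
      refine ((h1.sub (((hvW z hz).mul (hvW z hz)).const_mul (1 / 2))).congr_coeff ?_ ?_
        ).congr_of_eventuallyEq (Eventually.of_forall fun w => ?_) <;> ring
    exact h2.hasDerivAt.differentiableAt.differentiableWithinAt

lemma laplacian_comp_add_left {f : ℂ → ℝ} (p z : ℂ) :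
    Laplacian.laplacian (fun w => f (p + w)) z = Laplacian.laplacian f (p + z) := by
  simp only [InnerProductSpace.laplacian_eq_iteratedFDeriv_complexPlane]
  rw [iteratedFDeriv_comp_add_left]

/-! ### Integration of the equation on the thrice punctured sphere -/

lemma hasWirtinger_norm_rpow (m : ℝ) {z : ℂ} (hz : z ≠ 0) :
    HasWirtinger (fun w => ((‖w‖ ^ m : ℝ) : ℂ)) (m / 2 / z * (‖z‖ ^ m : ℝ))
      (m / 2 / conj z * (‖z‖ ^ m : ℝ)) z := by
  have hcz : conj z ≠ 0 := (map_ne_zero _).2 hz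
  have e : ∀ w : ℂ, ((‖w‖ ^ m : ℝ) : ℂ) = (w * conj w) ^ ((m / 2 : ℝ) : ℂ) := fun w => by
    rw [SolvesLiouville.norm_sq_eq, ← Complex.ofReal_cpow (by positivity), ← Real.rpow_natCast,
      ← Real.rpow_mul (norm_nonneg w)]
    congr 2
    push_cast
    ring
  have hs : z * conj z ∈ Complex.slitPlane := by
    rw [SolvesLiouville.norm_sq_eq, Complex.ofReal_mem_slitPlane]
    have := norm_pos_iff.2 hz
    positivity
  have h1 := (HasWirtinger.id z).mul (HasWirtinger.id z).conjugate
  have h2 := HasWirtinger.comp_left (F := fun w => w * conj w)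
    (((hasDerivAt_id (z * conj z)).cpow_const (c := ((m / 2 : ℝ) : ℂ)) hs)) h1
  simp only [e]
  refine h2.congr_coeff ?_ ?_
  · simp only [id, map_zero, mul_zero, add_zero, one_mul, mul_one]
    rw [Complex.cpow_sub _ _ (mul_ne_zero hz hcz), Complex.cpow_one]
    push_cast
    field_simp
  · simp only [id, map_one, zero_mul, zero_add, mul_one]
    rw [Complex.cpow_sub _ _ (mul_ne_zero hz hcz), Complex.cpow_one]
    push_cast
    field_simp

lemma isOpen_compl_zero_one : IsOpen ({0, 1}ᶜ : Set ℂ) :=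
  (Set.toFinite {(0 : ℂ), 1}).isClosed.isOpen_compl

lemma isPreconnected_compl_zero_one : IsPreconnected ({0, 1}ᶜ : Set ℂ) :=
  ((Set.toFinite {(0 : ℂ), 1}).countable.isPathConnected_compl_of_one_lt_rank
    (by rw [Complex.rank_real_complex]; norm_num)).isConnected.isPreconnected

lemma mem_compl_zero_one {z : ℂ} : z ∈ ({0, 1}ᶜ : Set ℂ) ↔ z ≠ 0 ∧ z ≠ 1 := by
  simp only [mem_compl_iff, mem_insert_iff, mem_singleton_iff, not_or]

lemma eq_of_hasWirtinger_zero {F : ℂ → ℂ} {U : Set ℂ} (hU : IsOpen U) (hc : IsPreconnected U)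
    (h : ∀ z ∈ U, HasWirtinger F 0 0 z) {z w : ℂ} (hz : z ∈ U) (hw : w ∈ U) : F z = F w := by
  refine hU.is_const_of_fderiv_eq_zero (𝕜 := ℝ) hc
    (fun x hx => (HasFDerivAt.differentiableAt (h x hx)).differentiableWithinAt)
    (fun x hx => ?_) hz hw
  rw [HasFDerivAt.fderiv (h x hx)]
  ext v
  simp

/-- A single-valued branch of `z^(μ-1) (z - 1)` on `ℂ ∖ {0, 1}` vanishes if `μ` is not an integer:
the equation is integrated once around each circle `|z| = |w|`, except the unit circle, which
meets the puncture and is reached by continuation. -/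
lemma eq_zero_of_monodromy {τ : ℂ → ℂ} {μ : ℝ} (hμ : ∀ n : ℤ, μ ≠ n)
    (hτ : ∀ z ∈ ({0, 1}ᶜ : Set ℂ), HasDerivAt τ (((μ - 1) / z + 1 / (z - 1)) * τ z) z)
    {z : ℂ} (hz : z ∈ ({0, 1}ᶜ : Set ℂ)) : τ z = 0 := by
  have off : ∀ w : ℂ, w ≠ 0 → ‖w‖ ≠ 1 → τ w = 0 := by
    intro w hw hw1
    set γ : ℝ → ℂ := fun θ => w * Complex.exp (θ * Complex.I) with hγ
    have hγn : ∀ θ, ‖γ θ‖ = ‖w‖ := fun θ => by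
      simp only [hγ, norm_mul, Complex.norm_exp_ofReal_mul_I, mul_one]
    have hγ0 : ∀ θ, γ θ ≠ 0 := fun θ => norm_pos_iff.1 (by rw [hγn]; exact norm_pos_iff.2 hw)
    have hγ1 : ∀ θ, γ θ - 1 ≠ 0 := fun θ e => by
      have := hγn θ
      rw [sub_eq_zero.1 e, norm_one] at this
      exact hw1 this.symm
    have hγU : ∀ θ, γ θ ∈ ({0, 1}ᶜ : Set ℂ) := fun θ =>
      mem_compl_zero_one.2 ⟨hγ0 θ, sub_ne_zero.1 (hγ1 θ)⟩
    have hγd : ∀ θ, HasDerivAt γ (γ θ * Complex.I) θ := fun θ => by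
      have h1 : HasDerivAt (fun θ : ℝ => (θ : ℂ) * Complex.I) Complex.I θ := by
        simpa using (Complex.ofRealCLM.hasDerivAt (x := θ)).mul_const Complex.I
      refine (h1.cexp.const_mul w).congr_deriv ?_
      simp only [hγ]
      ring
    set f : ℝ → ℂ := fun θ => τ (γ θ) / (γ θ - 1) * Complex.exp (-(μ - 1) * (θ * Complex.I)) with hf
    have hfd : ∀ θ, HasDerivAt f 0 θ := by
      intro θ
      have h1 : HasDerivAt (fun θ => τ (γ θ)) _ θ := (hτ _ (hγU θ)).comp θ (hγd θ)
      have h2 : HasDerivAt (fun θ : ℝ => -(μ - 1) * ((θ : ℂ) * Complex.I))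
          (-(μ - 1) * Complex.I) θ := by
        simpa using ((Complex.ofRealCLM.hasDerivAt (x := θ)).mul_const Complex.I).const_mul
          (-((μ : ℂ) - 1))
      refine ((h1.div ((hγd θ).sub_const 1) (hγ1 θ)).mul h2.cexp).congr_deriv ?_
      have := hγ0 θ
      have := hγ1 θ
      simp only [Pi.div_apply]
      field_simp
      ring
    have hconst : f 0 = f (2 * Real.pi) :=
      is_const_of_deriv_eq_zero (fun θ => (hfd θ).differentiableAt) (fun θ => (hfd θ).deriv) _ _
    have hγ00 : γ 0 = w := by simp [hγ]
    have hγ2 : γ (2 * Real.pi) = w := by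
      simp only [hγ]
      push_cast
      rw [Complex.exp_two_pi_mul_I, mul_one]
    simp only [hf, hγ00, hγ2] at hconst
    by_contra hne
    have hw1' : w - 1 ≠ 0 := by simpa [hγ00] using hγ1 0
    have h3 := mul_left_cancel₀ (div_ne_zero hne hw1') hconst
    simp only [Complex.ofReal_zero, zero_mul, mul_zero, Complex.exp_zero] at h3
    obtain ⟨n, hn⟩ := Complex.exp_eq_one_iff.1 h3.symm
    push_cast at hn
    have h4 : (2 * Real.pi * Complex.I : ℂ) ≠ 0 := Complex.two_pi_I_ne_zero
    have h5 : (μ : ℂ) = ((1 - n : ℤ) : ℂ) := by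
      push_cast
      refine mul_left_cancel₀ h4 ?_
      linear_combination -hn
    exact hμ (1 - n) (by exact_mod_cast h5)
  have han : AnalyticOnNhd ℂ τ ({0, 1}ᶜ : Set ℂ) := DifferentiableOn.analyticOnNhd
    (fun w hw => (hτ w hw).differentiableAt.differentiableWithinAt) isOpen_compl_zero_one
  have h2 : (2 : ℂ) ∈ ({0, 1}ᶜ : Set ℂ) := mem_compl_zero_one.2 (by norm_num)
  refine han.eqOn_zero_of_preconnected_of_eventuallyEq_zero isPreconnected_compl_zero_one h2 ?_ hz
  have : {w : ℂ | 1 < ‖w‖} ∈ 𝓝 (2 : ℂ) :=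
    (isOpen_lt continuous_const continuous_norm).mem_nhds (by simp)
  filter_upwards [this] with w hw
  exact off w (norm_pos_iff.1 (one_pos.trans hw)) hw.ne'

namespace SolvesLiouville

variable {φ : ℂ → ℝ} {s q : ℂ → ℂ}

/-- If the projective connection is that of `g = z^μ (z - (μ + 1) / μ)` with `μ` not an integer,
then `φ` is `(α + γ |g|²) / |g'|` up to constants. With `E = |z|^(μ-1) |z - 1|`, a multiple of
`|g'|`, the function `χ = E φ` satisfies `∂²χ = N ∂χ` where `N = g'' / g'`; hence `∂∂̄χ / |g'|²` is
constant, and subtracting a multiple of `|g|²` leaves a function whose `∂`-derivative is a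
single-valued multiple of `g'`, so zero. -/
theorem eq_explicit (h : SolvesLiouville φ s q {0, 1}ᶜ) {μ : ℝ} (hμ : ∀ n : ℤ, μ ≠ n)
    (hq : ∀ z ∈ ({0, 1}ᶜ : Set ℂ), q z = (1 - μ ^ 2) / (2 * z ^ 2) - 3 / (2 * (z - 1) ^ 2) -
      (μ - 1) / (z * (z - 1))) :
    ∃ γ : ℝ, 0 < γ ∧ ∀ z ∈ ({0, 1}ᶜ : Set ℂ), φ z * (‖z‖ ^ (μ - 1) * ‖z - 1‖) =
      1 / (4 * γ) + γ / (μ + 1) ^ 2 * (‖z‖ ^ (2 * μ) * ‖z - (μ + 1) / μ‖ ^ 2) := by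
  have hμ0 : (μ : ℂ) ≠ 0 := by
    have := hμ 0
    push_cast at this
    exact_mod_cast this
  have hμ1 : (μ : ℂ) + 1 ≠ 0 := by
    have := hμ (-1)
    push_cast at this
    intro e
    exact this (by exact_mod_cast (eq_neg_of_add_eq_zero_left e))
  have hμ1r : μ + 1 ≠ 0 := by exact_mod_cast hμ1
  set N : ℂ → ℂ := fun z => (μ - 1) / z + 1 / (z - 1) with hN
  set N' : ℂ → ℂ := fun z => -(μ - 1) / z ^ 2 - 1 / (z - 1) ^ 2 with hN'
  set E : ℂ → ℝ := fun z => ‖z‖ ^ (μ - 1) * ‖z - 1‖ with hE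
  have nz : ∀ z ∈ ({0, 1}ᶜ : Set ℂ), z ≠ 0 ∧ z - 1 ≠ 0 := fun z hz =>
    ⟨(mem_compl_zero_one.1 hz).1, sub_ne_zero.2 (mem_compl_zero_one.1 hz).2⟩
  have hEpos : ∀ z ∈ ({0, 1}ᶜ : Set ℂ), 0 < E z := fun z hz =>
    mul_pos (Real.rpow_pos_of_pos (norm_pos_iff.2 (nz z hz).1) _) (norm_pos_iff.2 (nz z hz).2)
  have hNW : ∀ z ∈ ({0, 1}ᶜ : Set ℂ), HasWirtinger N (N' z) 0 z := fun z hz => by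
    obtain ⟨h0, h1⟩ := nz z hz
    refine .of_hasDerivAt ((((hasDerivAt_const z ((μ : ℂ) - 1)).div (hasDerivAt_id z) h0).add
      ((hasDerivAt_const z (1 : ℂ)).div ((hasDerivAt_id z).sub_const 1) h1)).congr_deriv ?_)
    simp only [hN', id]
    ring
  have hEW : ∀ z ∈ ({0, 1}ᶜ : Set ℂ), HasWirtinger (fun z => (E z : ℂ)) (N z / 2 * E z)
      (conj (N z) / 2 * E z) z := fun z hz => by
    obtain ⟨h0, h1⟩ := nz z hz
    have h0' : conj z ≠ 0 := (map_ne_zero _).2 h0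
    have h1' : conj z - 1 ≠ 0 := by simpa using (map_ne_zero (starRingEnd ℂ)).2 h1
    have e1 := hasWirtinger_norm_rpow (μ - 1) h0
    have e2 := HasWirtinger.comp_right (F := fun w : ℂ => ((‖w‖ ^ (1 : ℝ) : ℝ) : ℂ))
      (h := fun z => z - 1) (hasWirtinger_norm_rpow 1 h1) ((hasDerivAt_id z).sub_const 1)
    simp only [Real.rpow_one] at e2
    simp only [hE, Complex.ofReal_mul]
    refine (e1.mul e2).congr_coeff ?_ ?_
    · simp only [hN]
      push_cast
      ring
    · simp only [hN, map_add, map_div₀, map_sub, Complex.conj_ofReal, map_one]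
      push_cast
      ring
  have hqN : ∀ z ∈ ({0, 1}ᶜ : Set ℂ), q z = N' z - N z ^ 2 / 2 := fun z hz => by
    obtain ⟨h0, h1⟩ := nz z hz
    rw [hq z hz]
    simp only [hN, hN']
    field_simp
    ring
  set t : ℂ → ℂ := fun z => E z * (s z + N z / 2 * φ z) with ht
  set W : ℂ → ℂ := fun z => (1 / 4 + s z * conj (s z)) / φ z + N z / 2 * conj (s z) +
    conj (N z) / 2 * s z + N z / 2 * (conj (N z) / 2) * φ z with hW
  have hχW : ∀ z ∈ ({0, 1}ᶜ : Set ℂ), HasWirtinger (fun z => (φ z : ℂ) * E z) (t z)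
      (conj (t z)) z :=
    fun z hz => by
      refine ((h.hasWirtinger z hz).mul (hEW z hz)).congr_coeff ?_ ?_
      · simp only [ht]; ring
      · simp only [ht, map_mul, map_add, map_div₀, Complex.conj_ofReal, map_ofNat]; ring
  have hN2W : ∀ z ∈ ({0, 1}ᶜ : Set ℂ), HasWirtinger (fun z => N z / 2) (N' z / 2) 0 z := fun z hz =>
    (((hNW z hz).const_mul (1 / 2)).congr_coeff (by ring) (by ring)).congr_of_eventuallyEq
      (Eventually.of_forall fun w => by ring)
  have hcN2W : ∀ z ∈ ({0, 1}ᶜ : Set ℂ), HasWirtinger (fun z => conj (N z) / 2) 0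
      (conj (N' z) / 2) z :=
    fun z hz => (((hNW z hz).conjugate.const_mul (1 / 2)).congr_coeff (by simp)
      (by ring)).congr_of_eventuallyEq (Eventually.of_forall fun w => by ring)
  have htW : ∀ z ∈ ({0, 1}ᶜ : Set ℂ), HasWirtinger t (N z * t z) (E z * W z) z := fun z hz => by
    refine ((hEW z hz).mul ((h.hasWirtinger_deriv z hz).add
      ((hN2W z hz).mul (h.hasWirtinger z hz)))).congr_coeff ?_ ?_
    · simp only [ht, hqN z hz]
      ring
    · simp only [hW]
      ring
  have hWW : ∀ z ∈ ({0, 1}ᶜ : Set ℂ), HasWirtinger W (N z / 2 * W z) (conj (N z) / 2 * W z) z :=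
    fun z hz => by
      have hφ := h.hasWirtinger z hz
      have hs := h.hasWirtinger_deriv z hz
      refine ((((h.hasWirtinger_mixed hz).add ((hN2W z hz).mul hs.conjugate)).add
        ((hcN2W z hz).mul hs)).add (((hN2W z hz).mul (hcN2W z hz)).mul hφ)).congr_coeff ?_ ?_
      · simp only [hW, hqN z hz, map_div₀, map_add, map_mul, Complex.conj_conj,
          Complex.conj_ofReal, map_one, map_ofNat]
        ring
      · simp only [hW, hqN z hz, map_div₀, map_mul, map_neg, Complex.conj_ofReal, map_ofNat,
          map_sub, map_pow]
        ring
  have hE0 : ∀ z ∈ ({0, 1}ᶜ : Set ℂ), (E z : ℂ) ≠ 0 := fun z hz => by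
    exact_mod_cast (hEpos z hz).ne'
  -- `∂∂̄χ / E²` is constant
  have hconst : ∀ z ∈ ({0, 1}ᶜ : Set ℂ), HasWirtinger (fun z => W z / E z) 0 0 z := fun z hz => by
    have := hE0 z hz
    refine ((hWW z hz).div (hEW z hz) this).congr_coeff ?_ ?_ <;> ring
  have h2 : (2 : ℂ) ∈ ({0, 1}ᶜ : Set ℂ) := mem_compl_zero_one.2 (by norm_num)
  have hWeq : ∀ z, z ∈ ({0, 1}ᶜ : Set ℂ) →
      W z = (((1 / 4 + ‖s z + N z / 2 * φ z‖ ^ 2) / φ z : ℝ) : ℂ) := fun z hz => by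
    have := h.ofReal_ne_zero hz
    push_cast
    have e : ((‖s z + N z / 2 * φ z‖ : ℝ) : ℂ) ^ 2 =
        (s z + N z / 2 * φ z) * conj (s z + N z / 2 * φ z) := by
      rw [norm_sq_eq]; push_cast; rfl
    rw [e]
    simp only [hW, map_add, map_mul, map_div₀, Complex.conj_ofReal, map_ofNat]
    field_simp
    ring
  set γ : ℝ := (1 / 4 + ‖s 2 + N 2 / 2 * φ 2‖ ^ 2) / φ 2 / E 2 with hγ
  have hγ0 : 0 < γ := by
    have := h.pos 2 h2
    have := hEpos 2 h2
    positivity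
  have hWγ : ∀ z ∈ ({0, 1}ᶜ : Set ℂ), W z = γ * E z := fun z hz => by
    have h3 := eq_of_hasWirtinger_zero isOpen_compl_zero_one isPreconnected_compl_zero_one
      hconst hz h2
    rw [hWeq 2 h2, ← Complex.ofReal_div, ← hγ, div_eq_iff (hE0 z hz)] at h3
    exact h3
  set a : ℂ := (μ + 1) / μ with ha
  have hca : conj a = a := by simp [ha]
  set G : ℂ → ℂ := fun z => (‖z‖ ^ (2 * μ) : ℝ) * ((z - a) * conj (z - a)) with hG
  set G₁ : ℂ → ℂ := fun z => (‖z‖ ^ (2 * μ) : ℝ) * ((μ + 1) * ((z - 1) / z) * conj (z - a)) with hG₁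
  have hR : ∀ z ∈ ({0, 1}ᶜ : Set ℂ), HasWirtinger (fun z => ((‖z‖ ^ (2 * μ) : ℝ) : ℂ))
      (μ / z * (‖z‖ ^ (2 * μ) : ℝ)) (μ / conj z * (‖z‖ ^ (2 * μ) : ℝ)) z := fun z hz => by
    refine (hasWirtinger_norm_rpow (2 * μ) (nz z hz).1).congr_coeff ?_ ?_ <;> push_cast <;> ring
  have hza : ∀ z : ℂ, HasWirtinger (fun z => z - a) 1 0 z := fun z =>
    ((HasWirtinger.id z).sub (HasWirtinger.const a z)).congr_coeff (by ring) (by ring)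
  have hE2 : ∀ z ∈ ({0, 1}ᶜ : Set ℂ), (E z : ℂ) ^ 2 =
      (‖z‖ ^ (2 * μ) : ℝ) / (z * conj z) * ((z - 1) * conj (z - 1)) := fun z hz => by
    have h0 := norm_pos_iff.2 (nz z hz).1
    rw [norm_sq_eq, norm_sq_eq]
    norm_cast
    simp only [hE]
    rw [mul_pow, ← Real.rpow_natCast (‖z‖ ^ (μ - 1)) 2, ← Real.rpow_mul h0.le]
    have : (μ - 1) * ((2 : ℕ) : ℝ) = 2 * μ - ((2 : ℕ) : ℝ) := by push_cast; ring
    rw [this, Real.rpow_sub_natCast h0.ne']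
  have hGW : ∀ z ∈ ({0, 1}ᶜ : Set ℂ), HasWirtinger G (G₁ z) (conj (G₁ z)) z := fun z hz => by
    obtain ⟨h0, h1⟩ := nz z hz
    have h0' : conj z ≠ 0 := (map_ne_zero _).2 h0
    refine ((hR z hz).mul ((hza z).mul (hza z).conjugate)).congr_coeff ?_ ?_
    · simp only [hG₁, ha, map_zero]
      field_simp
      ring
    · simp only [hG₁, map_mul, map_sub, map_div₀, map_add, Complex.conj_ofReal, map_one, hca,
        Complex.conj_conj]
      simp only [ha]
      field_simp
      ring
  have hG₁W : ∀ z ∈ ({0, 1}ᶜ : Set ℂ), HasWirtinger G₁ (N z * G₁ z) ((μ + 1) ^ 2 * E z ^ 2) z :=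
    fun z hz => by
      obtain ⟨h0, h1⟩ := nz z hz
      have h0' : conj z ≠ 0 := (map_ne_zero _).2 h0
      have e1 : HasWirtinger (fun z : ℂ => (μ + 1) * ((z - 1) / z)) ((μ + 1) * (1 / z ^ 2)) 0
          z := by
        refine .of_hasDerivAt (((((hasDerivAt_id z).sub_const 1).div (hasDerivAt_id z) h0).const_mul
          ((μ : ℂ) + 1)).congr_deriv ?_)
        simp only [id]
        ring
      refine ((hR z hz).mul (e1.mul (hza z).conjugate)).congr_coeff ?_ ?_
      · simp only [hG₁, hN, map_zero]
        field_simp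
        ring
      · rw [hE2 z hz]
        simp only [map_sub, map_one, hca]
        simp only [ha]
        field_simp
        ring
  set Γ : ℂ := γ / (μ + 1) ^ 2 with hΓ
  -- `∂(χ - Γ |g|²)` is a single-valued multiple of `g'`
  have hτ : ∀ z ∈ ({0, 1}ᶜ : Set ℂ), t z - Γ * G₁ z = 0 := fun z hz => by
    refine eq_zero_of_monodromy (τ := fun z => t z - Γ * G₁ z) hμ (fun w hw => ?_) hz
    refine HasWirtinger.hasDerivAt (((htW w hw).sub ((hG₁W w hw).const_mul Γ)).congr_coeff ?_ ?_)
    · simp only [hN]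
      ring
    · rw [hWγ w hw, hΓ]
      field_simp
      ring
  have hηW : ∀ z ∈ ({0, 1}ᶜ : Set ℂ), HasWirtinger (fun z => (φ z : ℂ) * E z - Γ * G z) 0 0 z :=
    fun z hz => by
      have hcΓ : conj Γ = Γ := by simp [hΓ]
      refine ((hχW z hz).sub ((hGW z hz).const_mul Γ)).congr_coeff (hτ z hz) ?_
      have := congrArg conj (hτ z hz)
      rwa [map_sub, map_mul (starRingEnd ℂ) Γ, hcΓ, map_zero] at this
  refine ⟨γ, hγ0, fun z hz => ?_⟩
  have hη := eq_of_hasWirtinger_zero isOpen_compl_zero_one isPreconnected_compl_zero_one hηW hz h2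
  -- Liouville's equation fixes the constant of integration
  have hval : (φ 2 : ℂ) * E 2 - Γ * G 2 = 1 / (4 * γ) := by
    have e1 : (φ 2 : ℂ) * E 2 * (E 2 * W 2) = (E 2 : ℂ) ^ 2 / 4 + t 2 * conj (t 2) := by
      have := h.ofReal_ne_zero h2
      simp only [hW, ht, map_mul, map_add, map_div₀, Complex.conj_ofReal, map_ofNat]
      field_simp
      ring
    have e2 : t 2 = Γ * G₁ 2 := sub_eq_zero.1 (hτ 2 h2)
    have hcΓ : conj Γ = Γ := by simp [hΓ]
    have e3 : G₁ 2 * conj (G₁ 2) = G 2 * ((μ + 1) ^ 2 * (E 2 : ℂ) ^ 2) := by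
      rw [hE2 2 h2]
      simp only [hG₁, hG, map_mul, map_sub, map_div₀, map_add, Complex.conj_ofReal, map_one, hca,
        map_ofNat]
      ring
    have hE2' := hE0 2 h2
    have hγc : (γ : ℂ) ≠ 0 := by exact_mod_cast hγ0.ne'
    rw [e2, map_mul, hcΓ, hWγ 2 h2] at e1
    have e4 : (E 2 : ℂ) ^ 2 * (γ * (φ 2 * E 2 - Γ * G 2)) = (E 2 : ℂ) ^ 2 * (1 / 4) := by
      have e5 : Γ * (μ + 1) ^ 2 = γ := by rw [hΓ]; field_simp
      linear_combination e1 + Γ ^ 2 * e3 + Γ * G 2 * (E 2 : ℂ) ^ 2 * e5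
    have e6 := mul_left_cancel₀ (pow_ne_zero 2 hE2') e4
    rw [eq_div_iff (mul_ne_zero (by norm_num : (4 : ℂ) ≠ 0) hγc)]
    linear_combination 4 * e6
  rw [hval] at hη
  have hGz : G z = ((‖z‖ ^ (2 * μ) * ‖z - (μ + 1) / μ‖ ^ 2 : ℝ) : ℂ) := by
    simp only [hG, norm_sq_eq, ha]
    push_cast
    rfl
  rw [hGz, hΓ] at hη
  have : ((φ z * (‖z‖ ^ (μ - 1) * ‖z - 1‖) : ℝ) : ℂ) = ((1 / (4 * γ) + γ / (μ + 1) ^ 2 *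
      (‖z‖ ^ (2 * μ) * ‖z - (μ + 1) / μ‖ ^ 2) : ℝ) : ℂ) := by
    push_cast
    push_cast at hη
    simp only [hE] at hη
    push_cast at hη
    linear_combination hη
  exact Complex.ofReal_injective this

end SolvesLiouville

/-! ### The logarithm on the universal covering -/

lemma IsLocalHomeomorph.locallyPathConnectedSpace {X Y : Type*} [TopologicalSpace X]
    [TopologicalSpace Y] [LocallyPathConnectedSpace Y] {f : X → Y} (hf : IsLocalHomeomorph f) :
    LocallyPathConnectedSpace X := by
  rw [locallyPathConnectedSpace_iff_pathComponentIn_mem_nhds]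
  intro x F hF hx
  obtain ⟨U, hU, hUf⟩ := isLocalHomeomorph_iff_isOpenEmbedding_restrict.1 hf x
  have := hUf.locallyPathConnectedSpace
  have hxU := mem_of_mem_nhds hU
  have h1 : pathComponentIn ((↑) ⁻¹' F : Set U) ⟨x, hxU⟩ ∈ 𝓝 (⟨x, hxU⟩ : U) :=
    pathComponentIn_mem_nhds ((hF.preimage continuous_subtype_val).mem_nhds hx)
  have h2 := image_mem_map (m := ((↑) : U → X)) h1
  rw [map_nhds_subtype_coe_eq_nhds hxU hU] at h2
  refine mem_of_superset h2 ?_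
  rintro _ ⟨y, hy, rfl⟩
  obtain ⟨γ, hγ⟩ : JoinedIn _ _ _ := hy
  exact ⟨γ.map continuous_subtype_val, fun t => hγ t⟩

/-- On a simply connected covering of a punctured sphere whose punctures include `0` and `∞`, the
coordinate `z` is a local homeomorphism to the plane with a continuous logarithm. -/
lemma exists_log_of_isCoveringMap {S : Finset RiemannSphere} (h0 : ((0 : ℂ) : OnePoint ℂ) ∈ S)
    (hinf : OnePoint.infty ∈ S) {E : Type*} [TopologicalSpace E] [SimplyConnectedSpace E]
    {π : E → {P : RiemannSphere // P ∉ S}} (hπ : IsCoveringMap π) :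
    ∃ L : E → ℂ, Continuous L ∧
      ∀ e, ((Complex.exp (L e) : ℂ) : OnePoint ℂ) = (π e : RiemannSphere) := by
  set ψ : {P : RiemannSphere // P ∉ S} → ℂ := fun P => RiemannSphere.coord ((0 : ℂ) : OnePoint ℂ) P
    with hψ
  have hcoe : ∀ P, ((ψ P : ℂ) : OnePoint ℂ) = (P : RiemannSphere) := by
    rintro ⟨P, hP⟩
    induction P using OnePoint.rec with
    | infty => exact absurd hinf hP
    | coe z => exact congrArg _ (sub_zero z)
  have hopen : IsOpen {P : RiemannSphere | P ∉ S} := S.finite_toSet.isClosed.isOpen_compl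
  have hψo : IsOpenEmbedding ψ := by
    rw [← IsOpenEmbedding.of_comp_iff ψ (OnePoint.isOpenEmbedding_coe (X := ℂ))]
    have : ((↑) : ℂ → OnePoint ℂ) ∘ ψ = Subtype.val := funext hcoe
    rw [this]
    exact hopen.isOpenEmbedding_subtypeVal
  have hloc : IsLocalHomeomorph (ψ ∘ π) := hψo.isLocalHomeomorph.comp hπ.isLocalHomeomorph
  have := hloc.locallyPathConnectedSpace
  have hψ0 : ∀ e, ψ (π e) ≠ 0 := fun e he => (π e).2 (by rw [← hcoe, he]; exact h0)
  obtain ⟨e₀⟩ : Nonempty E := inferInstance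
  obtain ⟨L, ⟨-, hL⟩, -⟩ := Complex.isCoveringMapOn_exp.existsUnique_continuousMap_lifts
    ⟨ψ ∘ π, hloc.continuous⟩ (Complex.exp_log (hψ0 e₀)) (fun e => hψ0 e)
  refine ⟨L, L.continuous, fun e => ?_⟩
  have : Complex.exp (L e) = ψ (π e) := congrFun hL e
  rw [this, hcoe]

/-- A holomorphic function of `log z` is a developing map as soon as it pulls back the
Fubini-Study metric to the given metric, written as `ρ |z|² |d log z|²`. -/
lemma SphereMetric.isDevelopingMap_comp_log {m : SphereMetric} {D : RiemannSphere →₀ ℝ} {E : Type*}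
    [TopologicalSpace E] {π : E → {P : RiemannSphere // P ∉ D.support}} {L : E → ℂ}
    (hL : Continuous L)
    (hexp : ∀ e, ((Complex.exp (L e) : ℂ) : OnePoint ℂ) = (π e : RiemannSphere)) {G : ℂ → ℂ}
    (hG : Differentiable ℂ G)
    (hm : ∀ ℓ, ((Complex.exp ℓ : ℂ) : OnePoint ℂ) ∉ D.support →
      m.fin (Complex.exp ℓ) * ‖Complex.exp ℓ‖ ^ 2 = 4 * ‖deriv G ℓ‖ ^ 2 / (1 + ‖G ℓ‖ ^ 2) ^ 2) :
    m.IsDevelopingMap π (fun e => ((G (L e) : ℂ) : OnePoint ℂ)) := by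
  intro e
  set p := Complex.exp (L e) with hp
  have hp0 : p ≠ 0 := Complex.exp_ne_zero _
  have hslit : ∀ᶠ ζ in 𝓝 (0 : ℂ), 1 + ζ / p ∈ Complex.slitPlane := by
    have : ContinuousAt (fun ζ : ℂ => 1 + ζ / p) 0 := by fun_prop
    exact this.eventually_mem (Complex.isOpen_slitPlane.mem_nhds (by simp))
  have hder : ∀ ζ : ℂ, 1 + ζ / p ∈ Complex.slitPlane →
      HasDerivAt (fun ζ => G (L e + Complex.log (1 + ζ / p)))
        (deriv G (L e + Complex.log (1 + ζ / p)) * (1 / (p + ζ))) ζ := by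
    intro ζ hζ
    have h1 : HasDerivAt (fun ζ : ℂ => 1 + ζ / p) (1 / p) ζ :=
      ((hasDerivAt_id ζ).div_const p).const_add 1
    have h2 := (h1.clog hζ).const_add (L e)
    refine ((hG _).hasDerivAt.comp ζ h2).congr_deriv ?_
    have h3 := Complex.slitPlane_ne_zero hζ
    have h4 : p + ζ = p * (1 + ζ / p) := by field_simp
    rw [h4]
    field_simp
  refine ⟨fun ζ => G (L e + Complex.log (1 + ζ / p)), ?_, Or.inl ?_, ?_⟩
  · rw [Complex.analyticAt_iff_eventually_differentiableAt]
    exact hslit.mono fun ζ hζ => (hder ζ hζ).differentiableAt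
  · -- `log` inverts `exp` at small arguments
    have : ∀ᶠ e' in 𝓝 e, L e' - L e ∈ {w : ℂ | -Real.pi < w.im ∧ w.im < Real.pi} := by
      have hc : ContinuousAt (fun e' => L e' - L e) e := (hL.sub continuous_const).continuousAt
      refine hc.eventually_mem (IsOpen.mem_nhds ?_ (by simp [Real.pi_pos]))
      exact (isOpen_lt continuous_const Complex.continuous_im).inter
        (isOpen_lt Complex.continuous_im continuous_const)
    filter_upwards [this] with e' he'
    rw [← hexp e, ← hexp e']
    have h1 : RiemannSphere.coord (Complex.exp (L e) : OnePoint ℂ)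
      (Complex.exp (L e') : OnePoint ℂ) =
      Complex.exp (L e') - p := rfl
    have h2 : 1 + (Complex.exp (L e') - p) / p = Complex.exp (L e' - L e) := by
      rw [Complex.exp_sub, ← hp]
      field_simp
      ring
    rw [h1, h2, Complex.log_exp he'.1 he'.2.le, add_sub_cancel]
  · have hS : ∀ᶠ ζ in 𝓝 (0 : ℂ), ((p + ζ : ℂ) : OnePoint ℂ) ∉ D.support := by
      have hc : ContinuousAt (fun ζ : ℂ => ((p + ζ : ℂ) : OnePoint ℂ)) 0 :=
        (OnePoint.continuous_coe.comp (continuous_const.add continuous_id)).continuousAt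
      refine hc.eventually_mem (D.support.finite_toSet.isClosed.isOpen_compl.mem_nhds ?_)
      simp only [add_zero, mem_compl_iff, Finset.mem_coe]
      rw [hp, hexp]
      exact (π e).2
    filter_upwards [hslit, hS] with ζ hζ hζS
    rw [(hder ζ hζ).deriv, ← hexp e]
    have h1 : Complex.exp (L e + Complex.log (1 + ζ / p)) = p + ζ := by
      rw [Complex.exp_add, Complex.exp_log (Complex.slitPlane_ne_zero hζ), ← hp]
      field_simp
    have h2 := hm (L e + Complex.log (1 + ζ / p)) (by rwa [h1])
    rw [h1] at h2
    have h3 : p + ζ ≠ 0 := h1 ▸ Complex.exp_ne_zero _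
    have h4 : ‖p + ζ‖ ≠ 0 := norm_ne_zero_iff.2 h3
    have h5 : m.density ((p : ℂ) : OnePoint ℂ) ζ = m.fin (p + ζ) := rfl
    rw [h5, eq_div_of_mul_eq (pow_ne_zero 2 h4) h2, norm_mul, norm_div, norm_one]
    field_simp

/-! ### Determination of the exponent -/

lemma compl_zero_one_mem_nhdsNE_zero : ({0, 1}ᶜ : Set ℂ) ∈ 𝓝[≠] (0 : ℂ) := by
  have : ({1}ᶜ : Set ℂ) ∈ 𝓝[≠] (0 : ℂ) := mem_nhdsWithin_of_mem_nhds
    (isOpen_compl_singleton.mem_nhds zero_ne_one)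
  filter_upwards [self_mem_nhdsWithin, this] with z h0 h1
  exact mem_compl_zero_one.2 ⟨h0, h1⟩

lemma preimage_compl_zero_one_mem_nhdsNE_zero :
    ((fun t : ℂ => 1 + t) ⁻¹' ({0, 1}ᶜ : Set ℂ)) ∈ 𝓝[≠] (0 : ℂ) := by
  have : ({-1}ᶜ : Set ℂ) ∈ 𝓝[≠] (0 : ℂ) := mem_nhdsWithin_of_mem_nhds
    (isOpen_compl_singleton.mem_nhds (by simp))
  filter_upwards [self_mem_nhdsWithin, this] with z h0 h1
  refine mem_compl_zero_one.2 ⟨fun h => h1 ?_, fun h => h0 ?_⟩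
  · exact eq_neg_of_add_eq_zero_right h
  · simpa using h

lemma compl_zero_one_mem_cocompact : ({0, 1}ᶜ : Set ℂ) ∈ cocompact ℂ :=
  (Set.toFinite {(0 : ℂ), 1}).isCompact.compl_mem_cocompact

namespace SolvesLiouville

variable {φ : ℂ → ℝ} {s q : ℂ → ℂ} {U : Set ℂ}

lemma comp_const_add (h : SolvesLiouville φ s q U) (p : ℂ) :
    SolvesLiouville (fun t => φ (p + t)) (fun t => s (p + t)) (fun t => q (p + t))
      ((fun t => p + t) ⁻¹' U) := by
  have := h.pullback (h.isOpen.preimage (continuous_const_add p)) (η := fun t => p + t)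
    (η' := fun _ => 1) (η'' := fun _ => 0) (ℓ := fun _ => 1) (ℓ' := fun _ => 0) (ℓ'' := fun _ => 0)
    (fun t _ => (hasDerivAt_id t).const_add p) (fun t _ => hasDerivAt_const t _)
    (fun t _ => hasDerivAt_const t _) (fun t _ => hasDerivAt_const t _)
    (differentiableOn_const _) (fun t ht => ht) (by simp) (by simp)
  simpa using this

/-- The conical orders determine the projective connection up to the accessory parameter, and the
absence of a logarithm at `1` makes the accessory parameter `μ` a square root of the exponents. -/
theorem exists_exponent (h : SolvesLiouville φ s q {0, 1}ᶜ) {β₁ β₂ C₀ C₁ C₂ : ℝ} (hβ₁ : -1 < β₁)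
    (hβ₂ : -1 < β₂) (hC₀ : 0 < C₀) (hC₁ : 0 < C₁) (hC₂ : 0 < C₂)
    (h₀ : Tendsto (fun z => φ z * ‖z‖ ^ β₁) (𝓝[≠] 0) (𝓝 C₀))
    (h₁ : Tendsto (fun t => φ (1 + t) * ‖t‖) (𝓝[≠] 0) (𝓝 C₁))
    (h₂ : Tendsto (fun z => φ z * ‖z‖ ^ (-β₂ - 2)) (cocompact ℂ) (𝓝 C₂)) :
    ∃ μ : ℝ, β₁ = |μ| - 1 ∧ β₂ = |μ + 1| - 1 ∧ ∀ z ∈ ({0, 1}ᶜ : Set ℂ),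
      q z = (1 - μ ^ 2) / (2 * z ^ 2) - 3 / (2 * (z - 1) ^ 2) - (μ - 1) / (z * (z - 1)) := by
  have hU₀ := compl_zero_one_mem_nhdsNE_zero
  have hU₁ := preimage_compl_zero_one_mem_nhdsNE_zero
  have hU₂ := compl_zero_one_mem_cocompact
  have hz₂ : ∀ᶠ z : ℂ in cocompact ℂ, z ≠ 0 := isCompact_singleton.compl_mem_cocompact
  have l₀ := (h.tendsto_of_conical modulusStable_nhdsNE_zero self_mem_nhdsWithin hU₀
    (α := β₁ + 1) (by linarith) hC₀ (by simpa using h₀)).2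
  have l₁ := ((h.comp_const_add 1).tendsto_of_conical modulusStable_nhdsNE_zero self_mem_nhdsWithin
    hU₁ (α := 2) two_ne_zero hC₁ (by norm_num; exact h₁)).2
  have l₂ := (h.tendsto_of_conical modulusStable_cocompact hz₂ hU₂ (α := -(β₂ + 1)) (by linarith)
    hC₂ (by ring_nf at h₂ ⊢; exact h₂)).2
  have l₁' : Tendsto (fun z => (z - 1) ^ 2 * q z) (𝓝[≠] 1) (𝓝 ((1 - ((2 : ℝ) : ℂ) ^ 2) / 2)) := by
    have ht : Tendsto (fun z : ℂ => z - 1) (𝓝[≠] 1) (𝓝[≠] 0) := by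
      refine tendsto_nhdsWithin_of_tendsto_nhds_of_eventually_within _ ?_ ?_
      · have : ContinuousAt (fun z : ℂ => z - 1) 1 := by fun_prop
        simpa [ContinuousAt] using this.mono_left nhdsWithin_le_nhds
      · filter_upwards [self_mem_nhdsWithin] with z hz
        exact sub_ne_zero.2 hz
    simpa [Function.comp_def] using l₁.comp ht
  have hq := fun z hz => eq_of_double_poles h.differentiableOn l₀ l₁' l₂ (z := z) hz
  set r : ℝ := ((β₁ + 1) ^ 2 - (β₂ + 1) ^ 2 + 3) / 2 with hr
  have hlog := (h.comp_const_add 1).no_log hU₁ hC₁ h₁ (q₁ := r)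
    (q₀ := (-1 - (β₁ + 1) ^ 2 + (β₂ + 1) ^ 2 / 2 : ℝ)) ?_
  · have hlog' : (-1 - (β₁ + 1) ^ 2 + (β₂ + 1) ^ 2 / 2) + r ^ 2 / 2 = 0 := by exact_mod_cast hlog
    have e1 : (1 - r) ^ 2 = (β₁ + 1) ^ 2 := by rw [hr] at hlog' ⊢; linarith
    have e2 : (1 - r + 1) ^ 2 = (β₂ + 1) ^ 2 := by rw [hr] at hlog' ⊢; linarith
    refine ⟨1 - r, ?_, ?_, fun z hz => ?_⟩
    · rw [← Real.sqrt_sq_eq_abs, e1, Real.sqrt_sq (by linarith)]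
      ring
    · rw [← Real.sqrt_sq_eq_abs, e2, Real.sqrt_sq (by linarith)]
      ring
    · obtain ⟨z0, z1⟩ := mem_compl_zero_one.1 hz
      have z1' := sub_ne_zero.2 z1
      have e := hq z hz
      have e1' : ((β₁ : ℂ) + 1) ^ 2 = (1 - r) ^ 2 := by exact_mod_cast e1.symm
      have e2' : ((β₂ : ℂ) + 1) ^ 2 = (1 - r + 1) ^ 2 := by exact_mod_cast e2.symm
      push_cast at e ⊢
      rw [neg_sq, e1', e2'] at e
      field_simp
      linear_combination 2 * e
  · have hc : ContinuousAt (fun t : ℂ => ((-1 - (β₁ + 1) ^ 2 + (β₂ + 1) ^ 2 / 2 : ℝ) - r * t) /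
        (1 + t) ^ 2) 0 := by
      refine ContinuousAt.div (by fun_prop) (by fun_prop) (by simp)
    have hc' := hc.continuousWithinAt (s := {0}ᶜ)
    simp only [ContinuousWithinAt, mul_zero, sub_zero, add_zero, one_pow, div_one] at hc'
    refine hc'.congr' ?_
    filter_upwards [hU₁, self_mem_nhdsWithin] with t ht ht0
    have e := hq _ ht
    have ht0 : t ≠ 0 := ht0
    have ht1 : 1 + t ≠ 0 := (mem_compl_zero_one.1 ht).1
    rw [add_sub_cancel_left] at e
    rw [eq_div_of_mul_eq (mul_ne_zero (pow_ne_zero 2 ht1) (pow_ne_zero 2 ht0)) e, hr]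
    push_cast
    field_simp
    ring

end SolvesLiouville

/-! ### The conformal metric -/

lemma tendsto_rpow_neg_half {l : Filter ℂ} {f : ℂ → ℝ} {κ c : ℝ} (hf : ∀ᶠ z in l, 0 < f z)
    (hc : 0 < c) (h : Tendsto (fun z => f z / ‖z‖ ^ (2 * κ)) l (𝓝 c)) :
    Tendsto (fun z => f z ^ (-1 / 2 : ℝ) * ‖z‖ ^ κ) l (𝓝 (c ^ (-1 / 2 : ℝ))) := by
  refine (h.rpow_const (Or.inl hc.ne')).congr' ?_
  filter_upwards [hf] with z hz
  rw [Real.div_rpow hz.le (by positivity), ← Real.rpow_mul (norm_nonneg z),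
    show 2 * κ * (-1 / 2) = -κ by ring, Real.rpow_neg (norm_nonneg z), div_inv_eq_mul]

namespace SphereMetric

/-- The conical asymptotics at `∞` in the coordinate `z`. -/
lemma tendsto_fin_cocompact (m : SphereMetric) {β c : ℝ}
    (h : Tendsto (fun w : ℂ => m.inf w / ‖w‖ ^ (2 * β)) (𝓝[≠] 0) (𝓝 c)) :
    Tendsto (fun z => m.fin z / ‖z‖ ^ (2 * (-β - 2))) (cocompact ℂ) (𝓝 c) := by
  rw [← Metric.cobounded_eq_cocompact]
  refine (h.comp tendsto_inv₀_cobounded').congr' ?_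
  have : ∀ᶠ z : ℂ in Bornology.cobounded ℂ, z ≠ 0 := by
    rw [Metric.cobounded_eq_cocompact]
    exact isCompact_singleton.compl_mem_cocompact
  filter_upwards [this] with z hz
  have h0 := norm_pos_iff.2 hz
  have e : (2 * (-β - 2)) = -(2 * β) - (4 : ℕ) := by push_cast; ring
  rw [Function.comp, m.compat _ (inv_ne_zero hz), inv_inv, norm_inv, e,
    Real.rpow_sub_natCast h0.ne', Real.rpow_neg h0.le, Real.inv_rpow h0.le]
  field_simp

/-- Where the metric is smooth of curvature `1`, the function `ρ^(-1/2)` solves Liouville's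
equation. -/
lemma IsMetOne.exists_solvesLiouville {m : SphereMetric} {D : RiemannSphere →₀ ℝ}
    (hm : m.IsMetOne D) {U : Set ℂ} (hU : IsOpen U)
    (hUD : ∀ z ∈ U, ((z : ℂ) : OnePoint ℂ) ∉ D.support) :
    (∀ z ∈ U, 0 < m.fin z) ∧
      ∃ s q : ℂ → ℂ, SolvesLiouville (fun z => m.fin z ^ (-1 / 2 : ℝ)) s q U := by
  have hpos : ∀ z ∈ U, 0 < m.fin z := fun z hz => by
    have := hm.pos _ (hUD z hz)
    rwa [show m.density ((z : ℂ) : OnePoint ℂ) 0 = m.fin (z + 0) from rfl, add_zero] at this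
  have hsmooth : ContDiffOn ℝ ((⊤ : ℕ∞) : WithTop ℕ∞) (fun z => Real.log (m.fin z)) U :=
    fun z hz => by
      have h1 : ContDiffAt ℝ ((⊤ : ℕ∞) : WithTop ℕ∞) (fun ζ => m.fin (z + ζ)) (z - z) := by
        rw [sub_self]
        exact hm.smooth _ (hUD z hz)
      have h2 := h1.comp (f := fun w => w - z) z (contDiffAt_id.sub contDiffAt_const)
      have h3 : ContDiffAt ℝ ((⊤ : ℕ∞) : WithTop ℕ∞) m.fin z := by
        simpa [Function.comp_def] using h2
      exact (h3.log (hpos z hz).ne').contDiffWithinAt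
  refine ⟨hpos, ?_⟩
  obtain ⟨s, q, h⟩ := _root_.exists_solvesLiouville hU hsmooth fun z hz => by
    have hd : m.density ((z : ℂ) : OnePoint ℂ) = fun ζ => m.fin (z + ζ) := rfl
    have h1 := hm.curvature _ (hUD z hz)
    rw [hd, gaussianCurvature] at h1
    rw [laplacian_comp_add_left (f := fun w => Real.log (m.fin w)), add_zero,
      div_eq_one_iff_eq (by have := hpos z hz; positivity)] at h1
    rw [Real.exp_log (hpos z hz)]
    linarith
  refine ⟨s, q, h.congr fun z hz => ?_⟩
  rw [Real.rpow_def_of_pos (hpos z hz)]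
  congr 1
  ring

end SphereMetric

/-- Solving `φ = ρ^(-1/2)` for `ρ` in the explicit formula for `φ` gives the Fubini-Study pull-back
by `c z^μ (z - (μ + 1) / μ)`. -/
lemma eq_fubiniStudy {ρ γ μ : ℝ} {z : ℂ} (hρ : 0 < ρ) (hγ : 0 < γ) (hμ : μ + 1 ≠ 0) (hz : z ≠ 0)
    (hz1 : z ≠ 1)
    (h : ρ ^ (-1 / 2 : ℝ) * (‖z‖ ^ (μ - 1) * ‖z - 1‖) =
      1 / (4 * γ) + γ / (μ + 1) ^ 2 * (‖z‖ ^ (2 * μ) * ‖z - (μ + 1) / μ‖ ^ 2)) :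
    ρ * ‖z‖ ^ 2 = 4 * (2 * γ * ‖z‖ ^ μ * ‖z - 1‖) ^ 2 /
      (1 + (2 * γ / (μ + 1) * ‖z‖ ^ μ * ‖z - (μ + 1) / μ‖) ^ 2) ^ 2 := by
  have h0 := norm_pos_iff.2 hz
  have h1 := norm_pos_iff.2 (sub_ne_zero.2 hz1)
  have e1 : ‖z‖ ^ (2 * μ) = (‖z‖ ^ μ) ^ 2 := by
    rw [← Real.rpow_natCast (‖z‖ ^ μ) 2, ← Real.rpow_mul h0.le]
    congr 1
    push_cast
    ring
  have e2 : (ρ ^ (-1 / 2 : ℝ)) ^ 2 * ρ = 1 := by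
    rw [← Real.rpow_natCast (ρ ^ (-1 / 2 : ℝ)) 2, ← Real.rpow_mul hρ.le]
    norm_num
    rw [Real.rpow_neg_one, inv_mul_cancel₀ hρ.ne']
  rw [e1, Real.rpow_sub_one h0.ne'] at h
  have hx : 0 < ‖z‖ ^ μ := Real.rpow_pos_of_pos h0 μ
  generalize ‖z - (μ + 1) / μ‖ = d at h ⊢
  generalize ‖z‖ ^ μ = x at h hx ⊢
  generalize ‖z - 1‖ = y at h h1 ⊢
  generalize ρ ^ (-1 / 2 : ℝ) = p at h e2
  generalize ‖z‖ = w at h h0 ⊢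
  have h2 : 1 + (2 * γ / (μ + 1) * x * d) ^ 2 = 4 * γ * (p * (x / w * y)) := by
    rw [h]
    field_simp
    ring
  have hp : p ≠ 0 := fun hp => by simp [hp] at e2
  rw [h2, eq_div_iff (by positivity)]
  field_simp
  linear_combination 4 * e2

end

theorem propositionA2 (m : SphereMetric) (β₁ β₂ : ℝ)
    (hβ₁ : ∀ n : ℤ, β₁ ≠ n) (hβ₂ : ∀ n : ℤ, β₂ ≠ n)
    (D : RiemannSphere →₀ ℝ)
    (hD : D = Finsupp.single ((0 : ℂ) : OnePoint ℂ) β₁ + Finsupp.single OnePoint.infty β₂ +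
      Finsupp.single ((1 : ℂ) : OnePoint ℂ) 1)
    (hm : m.IsMetOne D) :
    ∃ (c : ℂ) (μ : ℝ), c ≠ 0 ∧ μ ≠ 0 ∧ β₁ = |μ| - 1 ∧ β₂ = |μ + 1| - 1 ∧
      -- for every universal covering `π : E → M` of the complement `M` of `{0, 1, ∞}`
      ∀ (E : Type*) [TopologicalSpace E] [SimplyConnectedSpace E]
        (π : E → {P : RiemannSphere // P ∉ D.support}), IsCoveringMap π →
        -- `L` is a branch on `E` of `log z`, so that `z = exp L` and `z ^ μ = exp (μ * L)`
        ∃ L : E → ℂ, Continuous L ∧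
          (∀ e, ((Complex.exp (L e) : ℂ) : OnePoint ℂ) = (π e : RiemannSphere)) ∧
          m.IsDevelopingMap π (fun e =>
            ((c * Complex.exp (μ * L e) * (Complex.exp (L e) - (μ + 1) / μ) : ℂ) :
              OnePoint ℂ)) := by
  have hD0 : D ((0 : ℂ) : OnePoint ℂ) = β₁ := by
    simp [hD]
  have hDinf : D OnePoint.infty = β₂ := by
    simp [hD]
  have hD1 : D ((1 : ℂ) : OnePoint ℂ) = 1 := by
    simp [hD]
  have hβ₁0 : β₁ ≠ 0 := by simpa using hβ₁ 0
  have hβ₂0 : β₂ ≠ 0 := by simpa using hβ₂ 0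
  have hS0 : ((0 : ℂ) : OnePoint ℂ) ∈ D.support := by rwa [Finsupp.mem_support_iff, hD0]
  have hSinf : OnePoint.infty ∈ D.support := by rwa [Finsupp.mem_support_iff, hDinf]
  have hS1 : ((1 : ℂ) : OnePoint ℂ) ∈ D.support := by simp [hD1]
  have hS : ∀ z ∈ ({0, 1}ᶜ : Set ℂ), ((z : ℂ) : OnePoint ℂ) ∉ D.support := fun z hz => by
    obtain ⟨h0, h1⟩ := mem_compl_zero_one.1 hz
    have h0' : ((0 : ℂ) : OnePoint ℂ) ≠ (z : OnePoint ℂ) :=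
      fun h => h0 (OnePoint.coe_injective h).symm
    have h1' : ((1 : ℂ) : OnePoint ℂ) ≠ (z : OnePoint ℂ) :=
      fun h => h1 (OnePoint.coe_injective h).symm
    rw [Finsupp.notMem_support_iff, hD]
    simp [h0', h1']
  obtain ⟨hpos, s, q, h⟩ := hm.exists_solvesLiouville isOpen_compl_zero_one hS
  obtain ⟨c₀, hc₀, l₀⟩ := hm.conical _ hS0
  obtain ⟨c₁, hc₁, l₁⟩ := hm.conical _ hS1
  obtain ⟨c₂, hc₂, l₂⟩ := hm.conical _ hSinf
  have hb₁ := hm.order_gt _ hS0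
  have hb₂ := hm.order_gt _ hSinf
  rw [show m.density ((0 : ℂ) : OnePoint ℂ) = fun ζ => m.fin (0 + ζ) from rfl, hD0] at l₀
  rw [show m.density ((1 : ℂ) : OnePoint ℂ) = fun ζ => m.fin (1 + ζ) from rfl, hD1] at l₁
  rw [show m.density OnePoint.infty = m.inf from rfl, hDinf] at l₂
  rw [hD0] at hb₁
  rw [hDinf] at hb₂
  simp only [zero_add] at l₀
  have hU₀ : ∀ᶠ z in 𝓝[≠] (0 : ℂ), 0 < m.fin z := by
    filter_upwards [compl_zero_one_mem_nhdsNE_zero] with z hz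
    exact hpos z hz
  have hU₁ : ∀ᶠ z in 𝓝[≠] (0 : ℂ), 0 < m.fin (1 + z) := by
    filter_upwards [preimage_compl_zero_one_mem_nhdsNE_zero] with z hz
    exact hpos _ hz
  have hU₂ : ∀ᶠ z in cocompact ℂ, 0 < m.fin z := by
    filter_upwards [compl_zero_one_mem_cocompact] with z hz
    exact hpos z hz
  obtain ⟨μ, hμ₁, hμ₂, hq⟩ := h.exists_exponent hb₁ hb₂ (Real.rpow_pos_of_pos hc₀ _)
    (Real.rpow_pos_of_pos hc₁ _) (Real.rpow_pos_of_pos hc₂ _) (tendsto_rpow_neg_half hU₀ hc₀ l₀)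
    (by simpa using tendsto_rpow_neg_half hU₁ hc₁ l₁)
    (tendsto_rpow_neg_half hU₂ hc₂ (m.tendsto_fin_cocompact l₂))
  have hμ : ∀ n : ℤ, μ ≠ n := fun n hn => hβ₁ (|n| - 1) (by rw [hμ₁, hn]; push_cast; rfl)
  have hμ0 : μ ≠ 0 := by simpa using hμ 0
  have hμ1 : μ + 1 ≠ 0 := fun h => hμ (-1) (by push_cast; linarith)
  obtain ⟨γ, hγ, hφ⟩ := h.eq_explicit hμ hq
  set c : ℂ := 2 * γ / (μ + 1) with hc
  have hμ0' : (μ : ℂ) ≠ 0 := by exact_mod_cast hμ0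
  have hμ1' : (μ : ℂ) + 1 ≠ 0 := by exact_mod_cast hμ1
  have hγ' : (γ : ℂ) ≠ 0 := by exact_mod_cast hγ.ne'
  refine ⟨c, μ, by simp [hc, hμ1', hγ'], hμ0, hμ₁, hμ₂, fun E _ _ π hπ => ?_⟩
  obtain ⟨L, hL, hexp⟩ := exists_log_of_isCoveringMap hS0 hSinf hπ
  refine ⟨L, hL, hexp, SphereMetric.isDevelopingMap_comp_log hL hexp
    (G := fun ℓ => c * Complex.exp (μ * ℓ) * (Complex.exp ℓ - (μ + 1) / μ)) (by fun_prop) ?_⟩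
  intro ℓ hℓ
  have hz0 : Complex.exp ℓ ≠ 0 := Complex.exp_ne_zero ℓ
  have hz1 : Complex.exp ℓ ≠ 1 := fun h => hℓ (h ▸ hS1)
  have hz := mem_compl_zero_one.2 ⟨hz0, hz1⟩
  have hnorm : ‖Complex.exp (μ * ℓ)‖ = ‖Complex.exp ℓ‖ ^ μ := by
    rw [Complex.norm_exp, Complex.norm_exp, ← Real.exp_mul, Complex.re_ofReal_mul, mul_comm]
  have hder : HasDerivAt (fun ℓ => c * Complex.exp (μ * ℓ) * (Complex.exp ℓ - (μ + 1) / μ))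
      (2 * γ * Complex.exp (μ * ℓ) * (Complex.exp ℓ - 1)) ℓ := by
    have h1 : HasDerivAt (fun ℓ : ℂ => Complex.exp (μ * ℓ)) (Complex.exp (μ * ℓ) * (μ * 1)) ℓ :=
      ((hasDerivAt_id ℓ).const_mul (μ : ℂ)).cexp
    refine ((h1.const_mul c).mul ((Complex.hasDerivAt_exp ℓ).sub_const _)).congr_deriv ?_
    rw [hc]
    field_simp
    ring
  have hcn : ‖c‖ ^ 2 = (2 * γ / (μ + 1)) ^ 2 := by
    rw [show c = ((2 * γ / (μ + 1) : ℝ) : ℂ) by rw [hc]; push_cast; rfl, Complex.norm_real,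
      Real.norm_eq_abs, sq_abs]
  rw [hder.deriv, eq_fubiniStudy (hpos _ hz) hγ hμ1 hz0 hz1 (hφ _ hz)]
  simp only [norm_mul, mul_pow, hnorm, hcn, Complex.norm_real, Real.norm_eq_abs, sq_abs,
    Complex.norm_ofNat]
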